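/- **Setting.** Let $d\ge 1$. Consider three cells; in each cell a transmitter with $d$ antennas can serve one of $K$ users, each having $2d$ receive antennas. Let $\mathbf H_{i,j}^k\in\mathbb C^{2d\times d}$ be the channel from transmitter $j$ to user $k$ of cell $i$; all entries of all these matrices are i.i.d. $\mathcal{CN}(0,1)$. Each transmitter sends symbols with covariance $\frac Pd\mathbf I_d$ and the noise is $\mathcal{CN}(0,\mathbf I_{2d})$. For a user $k$ of cell $i$ let $p=i+1$, $q=i+2$ (mod 3) and let $\mathbf Q_{ip}^k,\mathbf Q_{iq}^k$ be matrices whose columns are orthonormal bases of the column spaces of $\mathbf H_{i,p}^k,\mathbf H_{i,q}^k$. Put $$\mathcal D_i^k=\tfrac12\big\|\mathbf Q_{ip}^k\mathbf Q_{ip}^{k\,\mathrm H}-\mathbf Q_{iq}^k\mathbf Q_{iq}^{k\,\mathrm H}\big\|_{\mathrm F}^2 ,$$ let the columns of $\mathbf U_i^k\in\mathbb C^{2d\times d}$ be orthonormal singular vectors for the $d$ smallest singular values of $\mathbf H_{i,p}^k\mathbf H_{i,p}^{k\,\mathrm H}+\mathbf H_{i,q}^k\mathbf H_{i,q}^{k\,\mathrm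 H}$ (chosen as a measurable function of this matrix), and let $$R_i^k(P)=\log_2\det\Big(\mathbf I_d+\tfrac Pd\mathbf U_i^{k\,\mathrm H}\mathbf H_{i,i}^k\mathbf H_{i,i}^{k\,\mathrm H}\mathbf U_i^k\Big(\tfrac Pd\sum_{j\ne i}\mathbf U_i^{k\,\mathrm H}\mathbf H_{i,j}^k\mathbf H_{i,j}^{k\,\mathrm H}\mathbf U_i^k+\mathbf I_d\Big)^{-1}\Big)$$ be the rate of this user when it is served. *Perfect real-valued feedback*: transmitter $i$ serves the user $k^\ast$ with the smallest $\mathcal D_i^k$, $1\le k\le K$. *1-bit feedback* with threshold $x_K$: transmitter $i$ serves a user $k^\dagger$ drawn uniformly at random (independently of the channels, given the feedback bits) among the users with $\mathcal D_i^k<x_K$, and among all $K$ users if there is none. The threshold is $$x_K=\Big(\frac{A\log K+B_K}{cK}\Big)^{1/d^2},\qquad A=\frac1{d^2},\qquad c=\frac1{\Gamma(d^2+1)}\prod_{i=1}^d\frac{\Gamma(2d-i+1)}{\Gamma(d-i+1)},$$ where $B_K$ is any real sequence with $B_K=o(\log K)$, for instance a constant (the finitely many $K$ for which $A\log K+B_K<0$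 are immaterial; there $x_K$ is set to some fixed real number). Let $$C(P)=\mathbb E\big[\log_2\det(\mathbf I_d+\tfrac Pd\mathbf G\mathbf G^{\mathrm H})\big],\qquad \mathbf G\in\mathbb C^{d\times d}\text{ with i.i.d. }\mathcal{CN}(0,1)\text{ entries},$$ be the ergodic capacity of the interference-free $d\times d$ point-to-point MIMO channel with input covariance $\frac Pd\mathbf I_d$. **Theorem.** Let the transmit power stay bounded as the number of users grows: $P=P_K\ge 0$ with $P_K=O(1)$ as $K\to\infty$ (for instance, $P$ fixed). Then, for every cell $i$, all the rates below have finite expectation, and as $K\to\infty$ $$\mathbb E\big[R_i^{k^\dagger}(P_K)\big]-\mathbb E\big[R_i^{k^\ast}(P_K)\big]\to0,\qquad \mathbb E\big[R_i^{k^\dagger}(P_K)\big]-C(P_K)\to0,\qquad \mathbb E\big[R_i^{k^\ast}(P_K)\big]-C(P_K)\to0 .$$ In particular, for a fixed power $P$, opportunistic interference alignment with 1-bit feedback and with perfect real-valued feedback achieve asymptotically the same rate, namely $C(P)$. -/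

import Mathlib

open MeasureTheory ProbabilityTheory Filter Topology Asymptotics
open scoped Matrix ComplexOrder

noncomputable section

/-- The circularly symmetric complex Gaussian law `CN(0,1)`: independent real and imaginary parts,
each `N(0,1/2)`. -/
def stdComplexGaussian : Measure ℂ :=
  ((gaussianReal 0 (1 / 2)).prod (gaussianReal 0 (1 / 2))).map
    (fun z : ℝ × ℝ => (⟨z.1, z.2⟩ : ℂ))

/-- The law of a `d × d` matrix with i.i.d. `CN(0,1)` entries. -/
def gaussianMatrixLaw (d : ℕ) : Measure (Fin d → Fin d → ℂ) :=
  Measure.pi fun _ => Measure.pi fun _ => stdComplexGaussian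

/-- `log₂ det (I + (P/d) G Gᴴ)`, the information rate of the interference-free `d × d`
point-to-point MIMO channel with realization `G` and input covariance `(P/d) I`. -/
def pointToPointRate (d : ℕ) (P : ℝ) (G : Matrix (Fin d) (Fin d) ℂ) : ℝ :=
  Real.logb 2 (1 + ((P / d : ℝ) : ℂ) • (G * Gᴴ)).det.re

/-- The ergodic capacity of the interference-free `d × d` point-to-point MIMO Rayleigh channel with
unit-variance noise and input covariance `(P/d) I`. -/
def ergodicCapacity (d : ℕ) (P : ℝ) : ℝ :=
  ∫ g, pointToPointRate d P (Matrix.of g) ∂(gaussianMatrixLaw d)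

/-- The chordal distance `(1/√2) ‖A Aᴴ - B Bᴴ‖_F`. -/
def chordalDist {m n : ℕ} (A B : Matrix (Fin m) (Fin n) ℂ) : ℝ :=
  1 / √2 * √(∑ a, ∑ b, ‖(A * Aᴴ - B * Bᴴ) a b‖ ^ 2)

/-- The matrix whose columns are obtained from the columns of `H` by Gram-Schmidt
orthonormalization; if `H` has full column rank these form an orthonormal basis of its column
space. -/
def orthBasis {m n : ℕ} (H : Matrix (Fin m) (Fin n) ℂ) : Matrix (Fin m) (Fin n) ℂ :=
  Matrix.of fun a b =>
    InnerProductSpace.gramSchmidtNormed ℂ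
      (fun c : Fin n => (WithLp.toLp 2 (fun a' => H a' c) : EuclideanSpace ℂ (Fin m))) b a

/-- The interference covariance matrix seen by a user with interference channels `Hp`, `Hq`. -/
def interferenceCov {d : ℕ} (Hp Hq : Matrix (Fin (2 * d)) (Fin d) ℂ) :
    Matrix (Fin (2 * d)) (Fin (2 * d)) ℂ :=
  Hp * Hpᴴ + Hq * Hqᴴ

/-- `u` computes a postfilter from the interference covariance matrix `R`: the columns of `u R` are
orthonormal singular vectors of `R` for its singular values number `d + 1, …, 2 d` in decreasing
order. As `R` is positive semidefinite, its singular values and vectors are its eigenvalues and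
eigenvectors (`eigenvalues₀` lists the eigenvalues in decreasing order, starting with index `0`). -/
structure IsPostfilter (d : ℕ)
    (u : Matrix (Fin (2 * d)) (Fin (2 * d)) ℂ → Matrix (Fin (2 * d)) (Fin d) ℂ) : Prop where
  measurable : ∀ a b, Measurable
    (fun r : Fin (2 * d) → Fin (2 * d) → ℂ => u (Matrix.of r) a b)
  orthonormal : ∀ R, R.PosSemidef → (u R)ᴴ * u R = 1
  singular : ∀ (R : Matrix (Fin (2 * d)) (Fin (2 * d)) ℂ) (hR : R.PosSemidef) (n : Fin d),
    R *ᵥ (fun a => u R a n) =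
      ((hR.isHermitian.eigenvalues₀
        ⟨d + n, by rw [Fintype.card_fin]; have := n.isLt; omega⟩ : ℝ) : ℂ) • (fun a => u R a n)

/-- The achievable instantaneous rate of a user with direct channel `Hd`, interference channels
`Hp`, `Hq` and postfilter `U`, at transmit power `P` and unit noise variance. -/
def instRate {d : ℕ} (P : ℝ) (Hd Hp Hq U : Matrix (Fin (2 * d)) (Fin d) ℂ) : ℝ :=
  Real.logb 2
    (1 + ((P / d : ℝ) : ℂ) • (Uᴴ * Hd * Hdᴴ * U) *
      (((P / d : ℝ) : ℂ) • (Uᴴ * Hp * Hpᴴ * U + Uᴴ * Hq * Hqᴴ * U) + 1)⁻¹).det.re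

section Network

variable {Ω : Type*} {d : ℕ}

/-- All scalar channel coefficients. The matrix `H i j k ω` is the channel from transmitter `j` to
user `k` of cell `i`. -/
def channelEntry (H : Fin 3 → Fin 3 → ℕ → Ω → Matrix (Fin (2 * d)) (Fin d) ℂ)
    (t : Fin 3 × Fin 3 × ℕ × Fin (2 * d) × Fin d) (ω : Ω) : ℂ :=
  H t.1 t.2.1 t.2.2.1 ω t.2.2.2.1 t.2.2.2.2

/-- All channel coefficients, of all cells, transmitters and users, are i.i.d. `CN(0,1)`. -/
structure IsIIDRayleigh [MeasurableSpace Ω] (μ : Measure Ω)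
    (H : Fin 3 → Fin 3 → ℕ → Ω → Matrix (Fin (2 * d)) (Fin d) ℂ) : Prop where
  measurable : ∀ t, Measurable (channelEntry H t)
  indep : iIndepFun (channelEntry H) μ
  law : ∀ t, HasLaw (channelEntry H t) stdComplexGaussian μ

/-- The σ-algebra generated by all channels. -/
abbrev channelSigma (H : Fin 3 → Fin 3 → ℕ → Ω → Matrix (Fin (2 * d)) (Fin d) ℂ) :
    MeasurableSpace Ω :=
  MeasurableSpace.comap (fun ω t => channelEntry H t ω) MeasurableSpace.pi

/-- The distance measure of user `k` in cell `i`: the squared chordal distance between the two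
interference subspaces. Addition in `Fin 3` is modulo `3`. -/
def userDist (H : Fin 3 → Fin 3 → ℕ → Ω → Matrix (Fin (2 * d)) (Fin d) ℂ)
    (i : Fin 3) (k : ℕ) (ω : Ω) : ℝ :=
  chordalDist (orthBasis (H i (i + 1) k ω)) (orthBasis (H i (i + 2) k ω)) ^ 2

/-- The instantaneous rate of user `k` in cell `i` if it is served. -/
def userRate (u : Matrix (Fin (2 * d)) (Fin (2 * d)) ℂ → Matrix (Fin (2 * d)) (Fin d) ℂ)
    (H : Fin 3 → Fin 3 → ℕ → Ω → Matrix (Fin (2 * d)) (Fin d) ℂ)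
    (P : ℝ) (i : Fin 3) (k : ℕ) (ω : Ω) : ℝ :=
  instRate P (H i i k ω) (H i (i + 1) k ω) (H i (i + 2) k ω)
    (u (interferenceCov (H i (i + 1) k ω) (H i (i + 2) k ω)))

/-- The user among `0, …, K - 1` with the smallest value of `D` (the first one in case of a tie). -/
def bestUser (D : ℕ → ℝ) (K : ℕ) : ℕ :=
  sInf {k | k < K ∧ ∀ l < K, D k ≤ D l}

open Classical in
/-- The users from which the transmitter draws under 1-bit feedback: those among `0, …, K - 1` that
report that their metric is smaller than the threshold `x`, and all users in case of a scheduling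
outage, that is, if there is no such user. -/
def oneBitCandidates (D : ℕ → ℝ) (x : ℝ) (K : ℕ) : Finset ℕ :=
  if ((Finset.range K).filter fun k => D k < x).Nonempty then
    (Finset.range K).filter fun k => D k < x
  else Finset.range K

open Classical in
/-- Given `m`, the random index `κ` is uniformly distributed on the random finite set `S`. -/
structure IsUniformPick (m : MeasurableSpace Ω) [mΩ : MeasurableSpace Ω] (μ : Measure Ω)
    (S : Ω → Finset ℕ) (κ : Ω → ℕ) : Prop where
  measurable : Measurable[mΩ] κ
  uniform : ∀ k : ℕ, μ[({ω | κ ω = k}).indicator (fun _ => (1 : ℝ)) | m] =ᵐ[μ]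
    fun ω => if k ∈ S ω then 1 / ((S ω).card : ℝ) else 0

end Network

/-- The volume constant `c_{2d,d}` of small balls in the Grassmannian of `d`-dimensional subspaces
of `ℂ^{2d}`. -/
def ballConst (d : ℕ) : ℝ :=
  1 / Real.Gamma ((d : ℝ) ^ 2 + 1) *
    ∏ i ∈ Finset.Icc 1 d, Real.Gamma (2 * (d : ℝ) - i + 1) / Real.Gamma ((d : ℝ) - i + 1)

/-- The threshold `x` with `c x ^ (d²) = (A log K + B) / K`, where `A = 1/d²` and `c = c_{2d,d}`. -/
def oneBitThreshold (d K : ℕ) (B : ℝ) : ℝ :=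
  ((1 / (d : ℝ) ^ 2 * Real.log K + B) / (ballConst d * K)) ^ (1 / (d : ℝ) ^ 2)

end

/-! The proof compares the rate of a served user with its interference-free rate, that is, the rate
with filtered direct channel `Uᴴ * Hd` and noise only. By `instRate_postfilter_bounds`, for linearly
independent columns of `Hq` the interference-free rate exceeds the true rate by at least zero and at
most a constant times `P * frobSq Hq * D`, where `D` is the squared chordal distance of the
interference subspaces. The reason is that the postfilter diagonalizes the interference covariance,
and its `d` smallest eigenvalues are at most `2 * frobSq Hq * D` by a Courant–Fischer argument
(`eigenvalues₀_interferenceCov_le`).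

The filter and the distances depend on interference channels only, so they are independent of the
direct channel, and `Uᴴ * Hd` is again an i.i.d. Gaussian `d × d` matrix. Hence any user selected
through the distances has mean interference-free rate exactly the ergodic capacity
(`integral_weight_mul_interferenceFreeRate`).

For the mean loss, unitary invariance makes the distance of two independent Gaussian column spaces
independent of the second matrix (`map_spanDist_prod_iidGaussian`). The factor `frobSq Hq` therefore
splits off, and what remains is the mean distance of the served user: at most the threshold, plus a
constant times the outage probability. This holds for both schemes, since the best user is below the
threshold as soon as some user is.

A ball of radius `x` around a subspace has probability at least `c * x ^ (d ^ 2)`, so an outage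
among `K` independent users has probability at most `exp (-c * x ^ (d ^ 2) * K)`. The threshold
tends to zero while `x ^ (d ^ 2) * K` grows at least like a multiple of `log K`, so the mean
distance vanishes, and with bounded power so does the loss. Only the order of the ball probability
matters, not the exact constant `ballConst`. -/

noncomputable section

/-! ### Gaussian matrices: full rank, unitary invariance, moments, small balls -/

/-- The law of an `m × n` matrix with i.i.d. `CN(0,1)` entries. -/
def iidGaussian (m n : ℕ) : Measure (Fin m → Fin n → ℂ) :=
  Measure.pi fun _ => Measure.pi fun _ => stdComplexGaussian

theorem stdComplexGaussian_eq_map_equiv :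
    stdComplexGaussian = ((gaussianReal 0 (1 / 2)).prod (gaussianReal 0 (1 / 2))).map
      Complex.measurableEquivRealProd.symm := rfl

instance : IsProbabilityMeasure stdComplexGaussian := by
  rw [stdComplexGaussian_eq_map_equiv]
  exact Measure.isProbabilityMeasure_map (by fun_prop)

instance (m n : ℕ) : IsProbabilityMeasure (iidGaussian m n) := by
  unfold iidGaussian; infer_instance

theorem stdComplexGaussian_absolutelyContinuous : stdComplexGaussian ≪ volume := by
  have h := Complex.volume_preserving_equiv_real_prod.symm
  rw [stdComplexGaussian_eq_map_equiv, ← h.map_eq]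
  refine Measure.AbsolutelyContinuous.map ?_ h.measurable
  exact (gaussianReal_absolutelyContinuous _ (by norm_num)).prod
    (gaussianReal_absolutelyContinuous _ (by norm_num))

theorem MeasureTheory.Measure.pi_absolutelyContinuous_pi {E : Type*} [MeasurableSpace E] :
    ∀ (n : ℕ) (μ ν : Fin n → Measure E) [∀ i, SigmaFinite (μ i)] [∀ i, SigmaFinite (ν i)],
      (∀ i, μ i ≪ ν i) → Measure.pi μ ≪ Measure.pi ν
  | 0, μ, ν, _, _, _ => by
      obtain rfl : μ = ν := Subsingleton.elim _ _
      exact Measure.AbsolutelyContinuous.rfl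
  | n + 1, μ, ν, _, _, h => by
      have hμ := (measurePreserving_piFinSuccAbove (α := fun _ => E) μ 0).symm
      have hν := (measurePreserving_piFinSuccAbove (α := fun _ => E) ν 0).symm
      rw [← hμ.map_eq, ← hν.map_eq]
      refine Measure.AbsolutelyContinuous.map ?_ hμ.measurable
      exact (h 0).prod (MeasureTheory.Measure.pi_absolutelyContinuous_pi n _ _ fun i => h _)

theorem iidGaussian_absolutelyContinuous (m n : ℕ) : iidGaussian m n ≪ volume :=
  Measure.pi_absolutelyContinuous_pi m _ _ fun _ =>
    Measure.pi_absolutelyContinuous_pi n _ _ fun _ => stdComplexGaussian_absolutelyContinuous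

/-- As a function of `t` this determinant is the characteristic polynomial of `-A`, which is monic
and hence has finitely many roots. -/
theorem Matrix.finite_setOf_det_add_smul_one_eq_zero {n : Type*} [Fintype n] [DecidableEq n]
    (A : Matrix n n ℂ) : {t : ℂ | (A + t • (1 : Matrix n n ℂ)).det = 0}.Finite := by
  have hne : (-A).charpoly ≠ 0 := (Matrix.charpoly_monic _).ne_zero
  refine (Polynomial.finite_setOfPred_isRoot hne).subset fun t ht => ?_
  simp only [Set.mem_ofPred_eq, Polynomial.IsRoot.def, Matrix.eval_charpoly] at ht ⊢
  rw [← ht]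
  congr 1
  ext i j
  simp [Matrix.scalar_apply, Matrix.smul_one_eq_diagonal, add_comm]

/-- A Gaussian matrix with at least as many rows as columns almost surely has full column rank. -/
theorem ae_linearIndependent_iidGaussian {m n : ℕ} (hnm : n ≤ m) :
    ∀ᵐ h ∂(iidGaussian m n), LinearIndependent ℂ (fun c : Fin n => fun a : Fin m => h a c) := by
  let top : (Fin m → Fin n → ℂ) → Matrix (Fin n) (Fin n) ℂ :=
    fun h => Matrix.of fun a b => h (Fin.castLE hnm a) b
  let E : Fin m → Fin n → ℂ := fun a b => if (a : ℕ) = b then 1 else 0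
  have hE : top E = 1 := by
    ext a b
    simp [top, E, Matrix.one_apply, Fin.ext_iff]
  have hmeas : MeasurableSet {h : Fin m → Fin n → ℂ | (top h).det ≠ 0} := by
    have hc : Continuous fun h : Fin m → Fin n → ℂ => (top h).det := by
      refine Continuous.matrix_det ?_
      exact continuous_matrix fun a b => by fun_prop
    exact (isOpen_ne_fun hc continuous_const).measurableSet
  have : (volume : Measure (Fin m → Fin n → ℂ)).IsAddHaarMeasure :=
    Measure.pi.isAddHaarMeasure (α := fun _ : Fin m => Fin n → ℂ) _
  have key : ∀ᵐ h : Fin m → Fin n → ℂ, h ∈ {h : Fin m → Fin n → ℂ | (top h).det ≠ 0} := by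
    -- On each complex line `y + t • E` the top block is `top y + t • 1`, singular for finitely many
    -- `t` only. Null sets on all parallel lines give a null set in the whole space.
    refine ae_mem_of_ae_add_linearMap_mem (LinearMap.toSpanSingleton ℂ (Fin m → Fin n → ℂ) E)
      (volume : Measure ℂ) volume hmeas fun y => ?_
    have hfin := Matrix.finite_setOf_det_add_smul_one_eq_zero (top y)
    have h0 : (volume : Measure ℂ) {t : ℂ | (top y + t • (1 : Matrix _ _ ℂ)).det = 0} = 0 :=
      hfin.measure_zero _
    refine measure_mono_null (fun t ht => ?_) h0
    simp only [LinearMap.toSpanSingleton_apply, Set.mem_ofPred_eq, Set.mem_compl_iff, not_not] at ht ⊢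
    rw [← ht, ← hE]
    rfl
  refine (iidGaussian_absolutelyContinuous m n).ae_le ?_
  filter_upwards [key] with h hh
  rw [Fintype.linearIndependent_iff]
  intro g hg
  have hz : top h *ᵥ g = 0 := by
    ext a
    have := congrFun hg (Fin.castLE hnm a)
    simpa [Matrix.mulVec, dotProduct, top, mul_comm] using this
  exact congrFun (Matrix.eq_zero_of_mulVec_eq_zero hh hz)

/-- Real and imaginary parts have variance `1 / 2` each, which together with the usual factor `1 /
2` in the exponent gives the `4`. -/
theorem charFunDual_stdComplexGaussian (L : StrongDual ℝ ℂ) :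
    charFunDual stdComplexGaussian L = Complex.exp (-((L 1 ^ 2 + L Complex.I ^ 2 : ℝ) : ℂ) / 4) := by
  rw [charFunDual_apply, stdComplexGaussian_eq_map_equiv, integral_map_equiv]
  have h1 : ∀ z : ℝ × ℝ, Complex.exp (L (Complex.measurableEquivRealProd.symm z) * Complex.I) =
      Complex.exp (z.1 * (L 1) * Complex.I) * Complex.exp (z.2 * (L Complex.I) * Complex.I) := by
    intro z
    have : Complex.measurableEquivRealProd.symm z = z.1 • (1 : ℂ) + z.2 • Complex.I := by
      apply Complex.ext <;> simp [Complex.measurableEquivRealProd_symm_apply]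
    rw [this, map_add, map_smul, map_smul, ← Complex.exp_add]
    congr 1
    push_cast [smul_eq_mul]
    ring
  simp_rw [h1]
  rw [integral_prod_mul (fun x : ℝ => Complex.exp (x * (L 1) * Complex.I))
    (fun x : ℝ => Complex.exp (x * (L Complex.I) * Complex.I))]
  have h2 : ∀ t : ℝ, ∫ x : ℝ, Complex.exp (x * t * Complex.I) ∂(gaussianReal 0 (1 / 2)) =
      Complex.exp (-(t : ℂ) ^ 2 / 4) := by
    intro t
    have := charFun_gaussianReal (μ := 0) (v := 1 / 2) t
    rw [charFun_apply_real] at this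
    simp_rw [mul_comm (t : ℂ)] at this
    rw [this]
    congr 1
    push_cast
    ring
  rw [h2, h2, ← Complex.exp_add]
  congr 1
  push_cast
  ring

theorem charFunDual_iidGaussian {m n : ℕ} (L : StrongDual ℝ (Fin m → Fin n → ℂ)) :
    charFunDual (iidGaussian m n) L = Complex.exp (-((∑ a, ∑ b,
      (L (Pi.single a (Pi.single b 1)) ^ 2 + L (Pi.single a (Pi.single b Complex.I)) ^ 2) : ℝ) : ℂ)
        / 4) := by
  unfold iidGaussian
  rw [charFunDual_pi]
  simp_rw [charFunDual_pi, charFunDual_stdComplexGaussian, ← Complex.exp_sum]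
  congr 1
  push_cast
  simp [Finset.sum_div, ← Finset.sum_neg_distrib]

/-- Left multiplication by a matrix with orthonormal rows preserves the i.i.d. Gaussian law. -/
theorem map_mul_iidGaussian {k m n : ℕ} (W : Matrix (Fin k) (Fin m) ℂ) (hW : W * Wᴴ = 1) :
    (iidGaussian m n).map (fun h => Matrix.of.symm (W * Matrix.of h)) = iidGaussian k n := by
  let T : (Fin m → Fin n → ℂ) →ₗ[ℝ] (Fin k → Fin n → ℂ) :=
    { toFun := fun h => Matrix.of.symm (W * Matrix.of h)
      map_add' := fun x y => by
        ext a b; simp [Matrix.mul_apply, mul_add, Finset.sum_add_distrib]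
      map_smul' := fun r x => by
        ext a b; simp [Matrix.mul_apply, Finset.mul_sum, mul_left_comm] }
  let T' : (Fin m → Fin n → ℂ) →L[ℝ] (Fin k → Fin n → ℂ) := LinearMap.toContinuousLinearMap T
  have hT : (fun h => Matrix.of.symm (W * Matrix.of h) : (Fin m → Fin n → ℂ) → _) = T' := rfl
  rw [hT]
  have : IsProbabilityMeasure ((iidGaussian m n).map T') :=
    Measure.isProbabilityMeasure_map (by fun_prop)
  refine Measure.ext_of_charFunDual ?_
  ext L
  rw [charFunDual_map, charFunDual_iidGaussian, charFunDual_iidGaussian]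
  congr 4
  -- `ℓ a b` represents `L` on the entry `(a, b)`
  let ℓ : Fin k → Fin n → ℂ := fun a b =>
    ⟨L (Pi.single a (Pi.single b 1)), -L (Pi.single a (Pi.single b Complex.I))⟩
  have hL : ∀ a b (z : ℂ), L (Pi.single a (Pi.single b z)) = (ℓ a b * z).re := by
    intro a b z
    have : (Pi.single a (Pi.single b z) : Fin k → Fin n → ℂ) =
        z.re • (Pi.single a (Pi.single b 1) : Fin k → Fin n → ℂ) +
          z.im • (Pi.single a (Pi.single b Complex.I) : Fin k → Fin n → ℂ) := by
      rw [← Pi.single_smul, ← Pi.single_smul, ← Pi.single_smul, ← Pi.single_smul, ← Pi.single_add,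
        ← Pi.single_add]
      congr 2
      apply Complex.ext <;> simp
    rw [this, map_add, map_smul, map_smul, Complex.mul_re]
    simp [ℓ, mul_comm]
  -- Composition with `T` multiplies each row vector `c ↦ ℓ c b` by `W` on the right. The
  -- characteristic function sees only the norms of these vectors, and `W * Wᴴ = 1` preserves them.
  have hTs : ∀ a b (z : ℂ), L (T (Pi.single a (Pi.single b z))) =
      ((∑ c, ℓ c b * W c a) * z).re := by
    intro a b z
    have : T (Pi.single a (Pi.single b z)) = ∑ c, Pi.single c (Pi.single b (W c a * z)) := by
      ext c e
      simp only [T, LinearMap.coe_mk, AddHom.coe_mk, Matrix.of_symm_apply, Matrix.mul_apply,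
        Matrix.of_apply, Finset.sum_apply]
      rw [Finset.sum_eq_single a (by intro x _ hx; simp [hx]) (by simp),
        Finset.sum_eq_single c (by intro x _ hx; simp [hx.symm]) (by simp)]
      by_cases h : e = b <;> simp [h]
    rw [this, map_sum]
    simp_rw [hL]
    rw [Finset.sum_mul, Complex.re_sum]
    simp_rw [mul_assoc]
  have hsq : ∀ w : ℂ, (w * 1).re ^ 2 + (w * Complex.I).re ^ 2 = Complex.normSq w := by
    intro w; simp [Complex.normSq_apply]; ring
  have e1 : ∀ a b, (L.comp T') (Pi.single a (Pi.single b 1)) ^ 2 +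
      (L.comp T') (Pi.single a (Pi.single b Complex.I)) ^ 2 =
        Complex.normSq (∑ c, ℓ c b * W c a) := by
    intro a b
    rw [← hsq, ← hTs, ← hTs]
    rfl
  simp_rw [e1, hL, hsq]
  rw [Finset.sum_comm, Finset.sum_comm (γ := Fin k)]
  refine Finset.sum_congr rfl fun b _ => ?_
  -- norm preservation for the row vector `ℓ · b`
  have e2 : ((∑ a, Complex.normSq (∑ c, ℓ c b * W c a) : ℝ) : ℂ) =
      ((∑ c, Complex.normSq (ℓ c b) : ℝ) : ℂ) := by
    have hdot : ∀ {j : ℕ} (v : Fin j → ℂ), ((∑ a, Complex.normSq (v a) : ℝ) : ℂ) = v ⬝ᵥ star v := by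
      intro j v
      push_cast
      simp [dotProduct, Complex.mul_conj]
    have : (fun a => ∑ c, ℓ c b * W c a) = (fun c => ℓ c b) ᵥ* W := by
      ext a; simp [Matrix.vecMul, dotProduct]
    rw [hdot (fun a => ∑ c, ℓ c b * W c a), hdot, this, Matrix.star_vecMul,
      Matrix.dotProduct_mulVec, Matrix.vecMul_vecMul, hW, Matrix.vecMul_one]
  exact_mod_cast e2

theorem integrable_normSq_stdComplexGaussian :
    Integrable (fun z : ℂ => ‖z‖ ^ 2) stdComplexGaussian := by
  rw [stdComplexGaussian_eq_map_equiv, integrable_map_equiv]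
  have hsq : Integrable (fun x : ℝ => x ^ 2) (gaussianReal 0 (1 / 2)) :=
    (memLp_id_gaussianReal 2).integrable_sq
  have := (hsq.comp_fst (gaussianReal 0 (1 / 2))).add (hsq.comp_snd (gaussianReal 0 (1 / 2)))
  refine this.congr (ae_of_all _ fun z => ?_)
  simp only [Function.comp_apply, Complex.measurableEquivRealProd_symm_apply, Complex.sq_norm,
    Complex.normSq_apply, Pi.add_apply]
  ring

theorem integrable_normSq_apply_iidGaussian {m n : ℕ} (a : Fin m) (b : Fin n) :
    Integrable (fun h => ‖h a b‖ ^ 2) (iidGaussian m n) := by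
  have h1 : MeasurePreserving (fun h : Fin m → Fin n → ℂ => h a b) (iidGaussian m n)
      stdComplexGaussian :=
    (measurePreserving_eval (fun _ : Fin n => stdComplexGaussian) b).comp
      (measurePreserving_eval (fun _ : Fin m => Measure.pi fun _ : Fin n => stdComplexGaussian) a)
  exact h1.integrable_comp_of_integrable integrable_normSq_stdComplexGaussian

theorem exists_le_gaussianReal_ball :
    ∃ c > 0, ∀ x r : ℝ, |x| ≤ 1 → 0 < r → r ≤ 1 →
      ENNReal.ofReal (c * r) ≤ gaussianReal 0 (1 / 2) (Metric.ball x r) := by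
  -- Points of the ball have modulus at most `|x| + r ≤ 2`, so the density at `2` bounds the density
  -- there from below.
  refine ⟨gaussianPDFReal 0 (1 / 2) 2, gaussianPDFReal_pos _ _ _ (by norm_num), fun x r hx hr hr1 => ?_⟩
  rw [gaussianReal_apply _ (by norm_num)]
  calc ENNReal.ofReal (gaussianPDFReal 0 (1 / 2) 2 * r)
      ≤ ENNReal.ofReal (gaussianPDFReal 0 (1 / 2) 2) * ENNReal.ofReal (2 * r) := by
        rw [← ENNReal.ofReal_mul (gaussianPDFReal_nonneg _ _ _)]
        refine ENNReal.ofReal_le_ofReal (mul_le_mul_of_nonneg_left (by linarith)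
          (gaussianPDFReal_nonneg _ _ _))
    _ = ∫⁻ y in Metric.ball x r, ENNReal.ofReal (gaussianPDFReal 0 (1 / 2) 2) := by
        rw [setLIntegral_const, Real.volume_ball]
    _ ≤ ∫⁻ y in Metric.ball x r, gaussianPDF 0 (1 / 2) y := by
        refine setLIntegral_mono (by fun_prop) fun y hy => ENNReal.ofReal_le_ofReal ?_
        have hy2 : |y| ≤ 2 := by
          rw [Metric.mem_ball, Real.dist_eq] at hy
          have := abs_sub_abs_le_abs_sub y x
          linarith
        unfold gaussianPDFReal
        refine mul_le_mul_of_nonneg_left (Real.exp_le_exp.2 ?_) (by positivity)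
        have : y ^ 2 ≤ 4 := by rw [← sq_abs]; nlinarith [abs_nonneg y]
        push_cast
        norm_num
        linarith

theorem exists_le_stdComplexGaussian_ball :
    ∃ c > 0, ∀ (z : ℂ) (r : ℝ), ‖z‖ ≤ 1 → 0 < r → r ≤ 1 →
      ENNReal.ofReal (c * r ^ 2) ≤ stdComplexGaussian (Metric.ball z r) := by
  obtain ⟨c, hc, h⟩ := exists_le_gaussianReal_ball
  refine ⟨c ^ 2 / 4, by positivity, fun z r hz hr hr1 => ?_⟩
  rw [stdComplexGaussian_eq_map_equiv, MeasurableEquiv.map_apply]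
  -- The open square with half-side `r / 2` and centre `z` lies in the ball, and its measure is a
  -- product.
  calc ENNReal.ofReal (c ^ 2 / 4 * r ^ 2) = ENNReal.ofReal (c * (r / 2)) * ENNReal.ofReal (c * (r / 2)) := by
        rw [← ENNReal.ofReal_mul (by positivity)]
        congr 1; ring
    _ ≤ gaussianReal 0 (1 / 2) (Metric.ball z.re (r / 2)) *
          gaussianReal 0 (1 / 2) (Metric.ball z.im (r / 2)) :=
        mul_le_mul' (h _ _ ((Complex.abs_re_le_norm z).trans hz) (by linarith) (by linarith))
          (h _ _ ((Complex.abs_im_le_norm z).trans hz) (by linarith) (by linarith))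
    _ = _ := (Measure.prod_prod _ _).symm
    _ ≤ _ := by
        refine measure_mono fun w hw => ?_
        simp only [Set.mem_prod, Metric.mem_ball, Real.dist_eq] at hw
        simp only [Set.mem_preimage, Metric.mem_ball, dist_eq_norm]
        refine (Complex.norm_le_abs_re_add_abs_im _).trans_lt ?_
        simp only [Complex.measurableEquivRealProd_symm_apply, Complex.sub_re, Complex.sub_im]
        linarith [hw.1, hw.2]


/-! ### Frobenius norm and chordal distance -/

/-- The squared Frobenius norm. -/
def frobSq {ι κ : Type*} [Fintype ι] [Fintype κ] (M : Matrix ι κ ℂ) : ℝ :=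
  ∑ a, ∑ b, ‖M a b‖ ^ 2

section Frobenius

variable {ι κ σ : Type*} [Fintype ι] [Fintype κ] [Fintype σ]

theorem frobSq_nonneg (M : Matrix ι κ ℂ) : 0 ≤ frobSq M := by
  unfold frobSq; positivity

theorem ofReal_frobSq (M : Matrix ι κ ℂ) : ((frobSq M : ℝ) : ℂ) = (Mᴴ * M).trace := by
  unfold frobSq
  rw [Finset.sum_comm]
  push_cast
  simp [Matrix.trace, Matrix.mul_apply, Complex.conj_mul']

theorem frobSq_conjTranspose (M : Matrix ι κ ℂ) : frobSq Mᴴ = frobSq M := by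
  unfold frobSq
  rw [Finset.sum_comm]
  simp

theorem frobSq_mul_of_isometry [DecidableEq ι] (W : Matrix σ ι ℂ) (hW : Wᴴ * W = 1)
    (M : Matrix ι κ ℂ) : frobSq (W * M) = frobSq M := by
  have : ((frobSq (W * M) : ℝ) : ℂ) = (frobSq M : ℝ) := by
    rw [ofReal_frobSq, ofReal_frobSq, Matrix.conjTranspose_mul, Matrix.mul_assoc,
      ← Matrix.mul_assoc Wᴴ, hW, Matrix.one_mul]
  exact_mod_cast this

theorem frobSq_mul_le (A : Matrix ι κ ℂ) (B : Matrix κ σ ℂ) :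
    frobSq (A * B) ≤ frobSq A * frobSq B := by
  unfold frobSq
  rw [Finset.sum_comm (s := (Finset.univ : Finset κ)), Finset.sum_mul]
  refine Finset.sum_le_sum fun a _ => ?_
  rw [Finset.mul_sum]
  refine Finset.sum_le_sum fun c _ => ?_
  rw [Matrix.mul_apply]
  calc ‖∑ b, A a b * B b c‖ ^ 2 ≤ (∑ b, ‖A a b‖ * ‖B b c‖) ^ 2 := by
        gcongr
        refine (norm_sum_le _ _).trans_eq ?_
        simp
    _ ≤ _ := Finset.sum_mul_sq_le_sq_mul_sq _ _ _

theorem sum_norm_sq_mulVec_le (A : Matrix ι κ ℂ) (v : κ → ℂ) :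
    ∑ a, ‖(A *ᵥ v) a‖ ^ 2 ≤ frobSq A * ∑ b, ‖v b‖ ^ 2 := by
  have := frobSq_mul_le A (Matrix.replicateCol Unit v)
  simpa [frobSq, Matrix.mul_apply, Matrix.mulVec, dotProduct] using this

/-- Pythagoras for the orthogonal projection `Q * Qᴴ`, applied to the columns of `X`. -/
theorem frobSq_sub_projection [DecidableEq κ] (Q : Matrix ι κ ℂ) (hQ : Qᴴ * Q = 1)
    (X : Matrix ι σ ℂ) : frobSq (X - Q * (Qᴴ * X)) = frobSq X - frobSq (Qᴴ * X) := by
  have : ((frobSq (X - Q * (Qᴴ * X)) : ℝ) : ℂ) = ((frobSq X - frobSq (Qᴴ * X) : ℝ) : ℂ) := by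
    push_cast
    rw [ofReal_frobSq, ofReal_frobSq, ofReal_frobSq, ← Matrix.trace_sub]
    congr 1
    have h : Qᴴ * (Q * (Qᴴ * X)) = Qᴴ * X := by rw [← Matrix.mul_assoc, hQ, Matrix.one_mul]
    simp only [Matrix.conjTranspose_sub, Matrix.conjTranspose_mul, Matrix.conjTranspose_conjTranspose,
      Matrix.sub_mul, Matrix.mul_sub, Matrix.mul_assoc, h]
    abel
  exact_mod_cast this

/-- Expanding the square, each projection has trace equal to its rank and both cross terms are the
squared norm of the overlap `Bᴴ * A`. -/
theorem frobSq_projection_sub_projection [DecidableEq κ] (A B : Matrix ι κ ℂ) (hA : Aᴴ * A = 1)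
    (hB : Bᴴ * B = 1) :
    1 / 2 * frobSq (A * Aᴴ - B * Bᴴ) = Fintype.card κ - frobSq (Bᴴ * A) := by
  have : ((1 / 2 * frobSq (A * Aᴴ - B * Bᴴ) : ℝ) : ℂ) =
      ((Fintype.card κ - frobSq (Bᴴ * A) : ℝ) : ℂ) := by
    push_cast
    rw [ofReal_frobSq, ofReal_frobSq]
    have h1 : ((A * Aᴴ) * (A * Aᴴ)).trace = Fintype.card κ := by
      rw [Matrix.mul_assoc, ← Matrix.mul_assoc Aᴴ, hA, Matrix.one_mul, Matrix.trace_mul_comm, hA,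
        Matrix.trace_one]
    have h2 : ((B * Bᴴ) * (B * Bᴴ)).trace = Fintype.card κ := by
      rw [Matrix.mul_assoc, ← Matrix.mul_assoc Bᴴ, hB, Matrix.one_mul, Matrix.trace_mul_comm, hB,
        Matrix.trace_one]
    have h3 : ((A * Aᴴ) * (B * Bᴴ)).trace = ((Bᴴ * A)ᴴ * (Bᴴ * A)).trace := by
      rw [Matrix.mul_assoc, Matrix.trace_mul_comm]
      simp only [Matrix.conjTranspose_mul, Matrix.conjTranspose_conjTranspose, Matrix.mul_assoc]
    have h4 : ((B * Bᴴ) * (A * Aᴴ)).trace = ((Bᴴ * A)ᴴ * (Bᴴ * A)).trace := by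
      rw [Matrix.trace_mul_comm, h3]
    have hh : (A * Aᴴ - B * Bᴴ)ᴴ = A * Aᴴ - B * Bᴴ := by
      simp [Matrix.conjTranspose_sub, Matrix.conjTranspose_mul]
    rw [hh, Matrix.sub_mul, Matrix.mul_sub, Matrix.mul_sub, Matrix.trace_sub, Matrix.trace_sub,
      Matrix.trace_sub, h1, h2, h3, h4]
    ring
  exact_mod_cast this

end Frobenius

theorem chordalDist_sq {m n : ℕ} (A B : Matrix (Fin m) (Fin n) ℂ) :
    chordalDist A B ^ 2 = 1 / 2 * frobSq (A * Aᴴ - B * Bᴴ) := by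
  change (1 / √2 * √(frobSq (A * Aᴴ - B * Bᴴ))) ^ 2 = _
  rw [mul_pow, div_pow, Real.sq_sqrt (by norm_num), Real.sq_sqrt (frobSq_nonneg _), one_pow]

theorem chordalDist_mul_unitary {m n : ℕ} (W : Matrix (Fin m) (Fin m) ℂ) (hW : Wᴴ * W = 1)
    (A B : Matrix (Fin m) (Fin n) ℂ) :
    chordalDist (W * A) (W * B) ^ 2 = chordalDist A B ^ 2 := by
  have hW' : Wᴴᴴ * Wᴴ = 1 := by
    rw [Matrix.conjTranspose_conjTranspose]; exact mul_eq_one_comm.1 hW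
  have : W * A * (W * A)ᴴ - W * B * (W * B)ᴴ = W * ((A * Aᴴ - B * Bᴴ) * Wᴴ) := by
    simp only [Matrix.conjTranspose_mul, Matrix.sub_mul, Matrix.mul_sub, Matrix.mul_assoc]
  rw [chordalDist_sq, chordalDist_sq, this, frobSq_mul_of_isometry _ hW, ← frobSq_conjTranspose,
    Matrix.conjTranspose_mul, Matrix.conjTranspose_conjTranspose, frobSq_mul_of_isometry _ hW,
    frobSq_conjTranspose]

/-! ### Gram–Schmidt bases and the distance of column spaces -/

section GramSchmidt

open InnerProductSpace

/-- The recursion involves only inner products and norms, which an isometry preserves. -/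
theorem gramSchmidt_map_linearIsometry {E F : Type*} [NormedAddCommGroup E]
    [InnerProductSpace ℂ E] [NormedAddCommGroup F] [InnerProductSpace ℂ F] {n : ℕ} (T : E →ₗᵢ[ℂ] F)
    (f : Fin n → E) (i : Fin n) :
    gramSchmidt ℂ (fun c => T (f c)) i = T (gramSchmidt ℂ f i) := by
  induction i using WellFoundedLT.induction with
  | ind i ih =>
    have h1 := gramSchmidt_def'' ℂ (fun c => T (f c)) i
    have h2 := congrArg T (gramSchmidt_def'' ℂ f i)
    rw [map_add, map_sum] at h2
    rw [h1] at h2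
    have h3 : ∑ x ∈ Finset.Iio i, (inner ℂ (gramSchmidt ℂ (fun c => T (f c)) x) (T (f i)) /
        (‖gramSchmidt ℂ (fun c => T (f c)) x‖ : ℂ) ^ 2) • gramSchmidt ℂ (fun c => T (f c)) x =
        ∑ x ∈ Finset.Iio i, T ((inner ℂ (gramSchmidt ℂ f x) (f i) /
        (‖gramSchmidt ℂ f x‖ : ℂ) ^ 2) • gramSchmidt ℂ f x) := by
      refine Finset.sum_congr rfl fun x hx => ?_
      rw [ih x (Finset.mem_Iio.1 hx), T.inner_map_map, T.norm_map, map_smul]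
    exact add_right_cancel (h2.trans (congrArg (T (gramSchmidt ℂ f i) + ·) h3.symm))

/-- The columns of a matrix as Euclidean vectors. -/
def euclCol {m n : ℕ} (H : Matrix (Fin m) (Fin n) ℂ) (c : Fin n) : EuclideanSpace ℂ (Fin m) :=
  WithLp.toLp 2 (fun a => H a c)

theorem orthBasis_apply {m n : ℕ} (H : Matrix (Fin m) (Fin n) ℂ) (a : Fin m) (b : Fin n) :
    orthBasis H a b = gramSchmidtNormed ℂ (euclCol H) b a := rfl

theorem inner_euclCol {m n k : ℕ} (A : Matrix (Fin m) (Fin n) ℂ) (B : Matrix (Fin m) (Fin k) ℂ)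
    (b : Fin n) (c : Fin k) : inner ℂ (euclCol A b) (euclCol B c) = (Aᴴ * B) b c := by
  simp [euclCol, EuclideanSpace.inner_eq_star_dotProduct, Matrix.mul_apply, dotProduct, mul_comm]

theorem conjTranspose_mul_self_eq_one_iff {m n : ℕ} (A : Matrix (Fin m) (Fin n) ℂ) :
    Aᴴ * A = 1 ↔ Orthonormal ℂ (euclCol A) := by
  rw [orthonormal_iff_ite, ← Matrix.ext_iff]
  simp only [inner_euclCol, Matrix.one_apply]

/-- Left multiplication by an isometric matrix, as a linear isometry. -/
def mulIsometry {m : ℕ} (W : Matrix (Fin m) (Fin m) ℂ) (hW : Wᴴ * W = 1) :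
    EuclideanSpace ℂ (Fin m) →ₗᵢ[ℂ] EuclideanSpace ℂ (Fin m) :=
  (Matrix.toEuclideanLin W).isometryOfInner fun x y => by
    simp only [EuclideanSpace.inner_eq_star_dotProduct, Matrix.ofLp_toLpLin, Matrix.toLin'_apply]
    rw [dotProduct_comm, Matrix.star_mulVec, Matrix.dotProduct_mulVec, Matrix.vecMul_vecMul, hW,
      Matrix.vecMul_one, dotProduct_comm]

theorem euclCol_mul {m n : ℕ} (W : Matrix (Fin m) (Fin m) ℂ) (hW : Wᴴ * W = 1)
    (H : Matrix (Fin m) (Fin n) ℂ) (c : Fin n) :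
    euclCol (W * H) c = mulIsometry W hW (euclCol H c) := by
  ext a
  simp [euclCol, mulIsometry, Matrix.mul_apply, Matrix.mulVec, dotProduct]

theorem orthBasis_mul_unitary {m n : ℕ} (W : Matrix (Fin m) (Fin m) ℂ) (hW : Wᴴ * W = 1)
    (H : Matrix (Fin m) (Fin n) ℂ) : orthBasis (W * H) = W * orthBasis H := by
  have h : ∀ c, gramSchmidtNormed ℂ (euclCol (W * H)) c =
      mulIsometry W hW (gramSchmidtNormed ℂ (euclCol H) c) := by
    intro c
    have : euclCol (W * H) = fun c => mulIsometry W hW (euclCol H c) :=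
      funext fun c => euclCol_mul W hW H c
    simp only [gramSchmidtNormed, this]
    rw [gramSchmidt_map_linearIsometry, map_smul, LinearIsometry.norm_map]
  have h2 : ∀ c, euclCol (orthBasis H) c = gramSchmidtNormed ℂ (euclCol H) c := fun c => rfl
  ext a b
  rw [orthBasis_apply, h, ← h2, ← euclCol_mul]
  rfl

theorem exists_eq_mul_of_euclCol_mem_span {m n k : ℕ} (A : Matrix (Fin m) (Fin n) ℂ)
    (B : Matrix (Fin m) (Fin k) ℂ)
    (h : ∀ c, euclCol A c ∈ Submodule.span ℂ (Set.range (euclCol B))) :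
    ∃ C : Matrix (Fin k) (Fin n) ℂ, A = B * C := by
  simp only [Submodule.mem_span_range_iff_exists_fun] at h
  choose C hC using h
  refine ⟨Matrix.of fun a c => C c a, ?_⟩
  ext a c
  have := congrArg (fun v : EuclideanSpace ℂ (Fin m) => v a) (hC c)
  simpa [euclCol, Matrix.mul_apply, mul_comm] using this.symm

theorem span_euclCol_orthBasis {m n : ℕ} (H : Matrix (Fin m) (Fin n) ℂ) :
    Submodule.span ℂ (Set.range (euclCol (orthBasis H))) =
      Submodule.span ℂ (Set.range (euclCol H)) :=
  (span_gramSchmidtNormed_range (𝕜 := ℂ) (euclCol H)).trans (span_gramSchmidt ℂ (euclCol H))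

theorem exists_orthBasis_eq_mul {m n : ℕ} (H : Matrix (Fin m) (Fin n) ℂ) :
    ∃ C : Matrix (Fin n) (Fin n) ℂ, orthBasis H = H * C :=
  exists_eq_mul_of_euclCol_mem_span _ _ fun c => by
    rw [← span_euclCol_orthBasis]; exact Submodule.subset_span ⟨c, rfl⟩

theorem exists_eq_orthBasis_mul {m n : ℕ} (H : Matrix (Fin m) (Fin n) ℂ) :
    ∃ C : Matrix (Fin n) (Fin n) ℂ, H = orthBasis H * C :=
  exists_eq_mul_of_euclCol_mem_span _ _ fun c => by
    rw [span_euclCol_orthBasis]; exact Submodule.subset_span ⟨c, rfl⟩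

theorem orthBasis_isometry {m n : ℕ} (H : Matrix (Fin m) (Fin n) ℂ)
    (hH : LinearIndependent ℂ (fun c : Fin n => fun a : Fin m => H a c)) :
    (orthBasis H)ᴴ * orthBasis H = 1 := by
  rw [conjTranspose_mul_self_eq_one_iff]
  refine gramSchmidtNormed_orthonormal (f := euclCol H) ?_
  exact hH.map' (WithLp.linearEquiv 2 ℂ (Fin m → ℂ)).symm.toLinearMap
    (LinearEquiv.ker _)

theorem orthBasis_projection_mul_self {m n : ℕ} (H : Matrix (Fin m) (Fin n) ℂ)
    (hH : LinearIndependent ℂ (fun c : Fin n => fun a : Fin m => H a c)) :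
    orthBasis H * (orthBasis H)ᴴ * H = H := by
  obtain ⟨C, hC⟩ := exists_eq_orthBasis_mul H
  have : orthBasis H * (orthBasis H)ᴴ * (orthBasis H * C) = orthBasis H * C := by
    rw [Matrix.mul_assoc, ← Matrix.mul_assoc (orthBasis H)ᴴ, orthBasis_isometry H hH, Matrix.one_mul]
  rwa [← hC] at this

/-- Normalized Gram–Schmidt vectors are unit vectors or zero, so no rank assumption is needed. -/
theorem norm_orthBasis_apply_le {m n : ℕ} (H : Matrix (Fin m) (Fin n) ℂ) (a : Fin m) (b : Fin n) :
    ‖orthBasis H a b‖ ≤ 1 := by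
  rw [orthBasis_apply]
  refine (PiLp.norm_apply_le _ a).trans ?_
  by_cases h : gramSchmidtNormed ℂ (euclCol H) b = 0
  · simp [h]
  · exact (gramSchmidtNormed_unit_length' h).le

/-- A crude bound without rank assumption; it suffices for integrability and for the contribution of
the outage event. -/
theorem chordalDist_orthBasis_sq_le {m n : ℕ} (A B : Matrix (Fin m) (Fin n) ℂ) :
    chordalDist (orthBasis A) (orthBasis B) ^ 2 ≤ 2 * (m * n : ℝ) ^ 2 := by
  have h : ∀ (A : Matrix (Fin m) (Fin n) ℂ) (a b : Fin m),
      ‖(orthBasis A * (orthBasis A)ᴴ) a b‖ ≤ n := by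
    intro A a b
    rw [Matrix.mul_apply]
    refine (norm_sum_le_of_le _ (f := fun _ : Fin n => _) (n := fun _ => (1 : ℝ)) fun c _ => ?_).trans
      (by simp)
    rw [norm_mul, Matrix.conjTranspose_apply, norm_star]
    exact mul_le_one₀ (norm_orthBasis_apply_le _ _ _) (norm_nonneg _) (norm_orthBasis_apply_le _ _ _)
  rw [chordalDist_sq]
  have : frobSq (orthBasis A * (orthBasis A)ᴴ - orthBasis B * (orthBasis B)ᴴ) ≤
      ∑ _a : Fin m, ∑ _b : Fin m, (2 * n : ℝ) ^ 2 := by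
    refine Finset.sum_le_sum fun a _ => Finset.sum_le_sum fun b _ => ?_
    gcongr
    rw [Matrix.sub_apply]
    refine (norm_sub_le _ _).trans ?_
    linarith [h A a b, h B a b]
  simp only [Finset.sum_const, Finset.card_univ, Fintype.card_fin, nsmul_eq_mul] at this
  nlinarith

/-- The matrix with orthonormal columns `e_1, …, e_n`. -/
def stdFrame (m n : ℕ) : Matrix (Fin m) (Fin n) ℂ :=
  Matrix.of fun a b => if (a : ℕ) = b then 1 else 0

theorem mul_stdFrame_apply {k m n : ℕ} (hnm : n ≤ m) (W : Matrix (Fin k) (Fin m) ℂ) (a : Fin k)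
    (b : Fin n) : (W * stdFrame m n) a b = W a (Fin.castLE hnm b) := by
  rw [Matrix.mul_apply, Finset.sum_eq_single (Fin.castLE hnm b)]
  · simp [stdFrame]
  · intro x _ hx
    have : (x : ℕ) ≠ b := fun h => hx (Fin.ext h)
    simp [stdFrame, this]
  · simp

theorem stdFrame_isometry {m n : ℕ} (hnm : n ≤ m) : (stdFrame m n)ᴴ * stdFrame m n = 1 := by
  ext a b
  rw [mul_stdFrame_apply hnm]
  simp [stdFrame, Matrix.one_apply, Fin.ext_iff, eq_comm, apply_ite]

/-- A matrix with orthonormal columns consists of the first columns of a unitary matrix. -/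
theorem exists_unitary_mul_stdFrame {m n : ℕ} (hnm : n ≤ m) (Q : Matrix (Fin m) (Fin n) ℂ)
    (hQ : Qᴴ * Q = 1) :
    ∃ W : Matrix (Fin m) (Fin m) ℂ, Wᴴ * W = 1 ∧ W * stdFrame m n = Q := by
  rw [conjTranspose_mul_self_eq_one_iff] at hQ
  let v : Fin m → EuclideanSpace ℂ (Fin m) :=
    fun i => if h : (i : ℕ) < n then euclCol Q ⟨i, h⟩ else 0
  let s : Set (Fin m) := {i | (i : ℕ) < n}
  have hv : Orthonormal ℂ (s.domRestrict v) := by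
    have : s.domRestrict v = euclCol Q ∘ fun i : s => (⟨i.1, i.2⟩ : Fin n) := by
      ext1 i
      have hi : ((i : Fin m) : ℕ) < n := i.2
      change v i.1 = _
      simp [v, hi]
    rw [this]
    exact hQ.comp _ fun i j hij => by
      simpa [Fin.ext_iff, Subtype.ext_iff] using hij
  obtain ⟨b, hb⟩ := hv.exists_orthonormalBasis_extension_of_card_eq (by simp)
  have hcol : euclCol (Matrix.of fun a i => b i a : Matrix (Fin m) (Fin m) ℂ) = b := by
    ext i a; simp [euclCol]
  refine ⟨Matrix.of fun a i => b i a, ?_, ?_⟩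
  · rw [conjTranspose_mul_self_eq_one_iff, hcol]
    exact b.orthonormal
  · ext a c
    rw [mul_stdFrame_apply hnm]
    have : b (Fin.castLE hnm c) = euclCol Q c := by
      rw [hb _ (show ((Fin.castLE hnm c : Fin m) : ℕ) < n from c.2)]
      simp [v]
    simp [this, euclCol]

/-- If `X` is close to `[1; 0]`, then so is its column space. -/
theorem chordalDist_orthBasis_stdFrame_sq_le {d : ℕ} (X : Matrix (Fin (2 * d)) (Fin d) ℂ)
    {ε : ℝ}
    (htop : ∀ (a : Fin (2 * d)) (b : Fin d), (a : ℕ) < d →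
      ‖X a b - stdFrame (2 * d) d a b‖ ≤ 1 / (2 * d))
    (hlow : ∀ (a : Fin (2 * d)) (b : Fin d), d ≤ (a : ℕ) → ‖X a b‖ ≤ ε) :
    chordalDist (orthBasis X) (stdFrame (2 * d) d) ^ 2 ≤ 8 * d ^ 3 * ε ^ 2 := by
  have hd2 : d ≤ 2 * d := by omega
  set E := stdFrame (2 * d) d with hE
  have hEE : Eᴴ * E = 1 := stdFrame_isometry hd2
  have hEX : ∀ {k : ℕ} (Y : Matrix (Fin (2 * d)) (Fin k) ℂ) a b,
      (Eᴴ * Y) a b = Y (Fin.castLE hd2 a) b := by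
    intro k Y a b
    have := mul_stdFrame_apply hd2 Yᴴ b a
    rw [← hE] at this
    rw [← Matrix.conjTranspose_conjTranspose (Eᴴ * Y), Matrix.conjTranspose_mul,
      Matrix.conjTranspose_conjTranspose, Matrix.conjTranspose_apply, this]
    simp
  have hEEX : ∀ {k : ℕ} (Y : Matrix (Fin d) (Fin k) ℂ) a b,
      (E * Y) a b = if h : (a : ℕ) < d then Y ⟨a, h⟩ b else 0 := by
    intro k Y a b
    rw [Matrix.mul_apply]
    split_ifs with h
    · rw [Finset.sum_eq_single ⟨a, h⟩]
      · simp [hE, stdFrame]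
      · intro x _ hx
        have : ¬ (a : ℕ) = x := fun h' => hx (Fin.ext h'.symm)
        simp [hE, stdFrame, this]
      · simp
    · refine Finset.sum_eq_zero fun x _ => ?_
      have : ¬ (a : ℕ) = x := fun h' => h (h' ▸ x.2)
      simp [hE, stdFrame, this]
  -- the upper block is a small perturbation of the identity
  have hΔ : frobSq (Eᴴ * X - 1) ≤ 1 / 4 := by
    calc frobSq (Eᴴ * X - 1) ≤ ∑ _a : Fin d, ∑ _b : Fin d, (1 / (2 * d : ℝ)) ^ 2 := by
          refine Finset.sum_le_sum fun a _ => Finset.sum_le_sum fun b _ => ?_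
          gcongr
          rw [Matrix.sub_apply, hEX]
          have e : (1 : Matrix (Fin d) (Fin d) ℂ) a b = E (Fin.castLE hd2 a) b := by
            simp [hE, stdFrame, Matrix.one_apply, Fin.ext_iff]
          rw [e]
          exact htop (Fin.castLE hd2 a) b a.2
      _ ≤ 1 / 4 := by
          simp only [Finset.sum_const, Finset.card_univ, Fintype.card_fin, nsmul_eq_mul]
          rcases Nat.eq_zero_or_pos d with h | h
          · subst h; norm_num
          · have : (0 : ℝ) < d := by exact_mod_cast h
            apply le_of_eq; field_simp; norm_num
  have hbelow : frobSq (X - E * (Eᴴ * X)) ≤ 2 * d * d * ε ^ 2 := by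
    calc frobSq (X - E * (Eᴴ * X)) ≤ ∑ _a : Fin (2 * d), ∑ _b : Fin d, ε ^ 2 := by
          refine Finset.sum_le_sum fun a _ => Finset.sum_le_sum fun b _ => ?_
          rw [Matrix.sub_apply, hEEX]
          split_ifs with h
          · rw [hEX]
            have : X a b - X (Fin.castLE hd2 ⟨a, h⟩) b = 0 := sub_self _
            rw [this]
            simpa using sq_nonneg ε
          · rw [sub_zero]
            gcongr
            exact hlow a b (not_lt.1 h)
      _ = 2 * d * d * ε ^ 2 := by
          simp only [Finset.sum_const, Finset.card_univ, Fintype.card_fin, nsmul_eq_mul]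
          push_cast; ring
  -- Here `C = Y - Z` with `frobSq Z ≤ frobSq C / 4`, so `frobSq C ≤ 2 * frobSq Y + frobSq C / 2`:
  -- the upper block is boundedly invertible. This yields both the full rank of `X` and the size of
  -- the coefficients expressing `orthBasis X` through `X`.
  have hcoef : ∀ {k : ℕ} (C : Matrix (Fin d) (Fin k) ℂ), frobSq C ≤ 4 * frobSq (Eᴴ * X * C) := by
    intro k C
    obtain ⟨Y, hY⟩ : ∃ Y : Matrix (Fin d) (Fin k) ℂ, Y = Eᴴ * X * C := ⟨_, rfl⟩
    obtain ⟨Z, hZ⟩ : ∃ Z : Matrix (Fin d) (Fin k) ℂ, Z = (Eᴴ * X - 1) * C := ⟨_, rfl⟩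
    have hCYZ : C = Y - Z := by
      rw [hY, hZ, Matrix.sub_mul, Matrix.one_mul, sub_sub_cancel]
    have h1 : frobSq C ≤ 2 * frobSq Y + 2 * frobSq Z := by
      have : ∀ a b, ‖C a b‖ ^ 2 ≤ 2 * ‖Y a b‖ ^ 2 + 2 * ‖Z a b‖ ^ 2 := by
        intro a b
        have := norm_sub_le (Y a b) (Z a b)
        rw [hCYZ, Matrix.sub_apply]
        nlinarith [norm_nonneg (Y a b - Z a b), sq_nonneg (‖Y a b‖ - ‖Z a b‖)]
      unfold frobSq
      rw [Finset.mul_sum, Finset.mul_sum, ← Finset.sum_add_distrib]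
      refine Finset.sum_le_sum fun a _ => ?_
      rw [Finset.mul_sum, Finset.mul_sum, ← Finset.sum_add_distrib]
      exact Finset.sum_le_sum fun b _ => this a b
    have h2 := frobSq_mul_le (Eᴴ * X - 1) C
    rw [← hZ] at h2
    rw [← hY]
    nlinarith [frobSq_nonneg C]
  have hind : LinearIndependent ℂ (fun c : Fin d => fun a : Fin (2 * d) => X a c) := by
    rw [Fintype.linearIndependent_iff]
    intro g hg
    have hz : X * Matrix.replicateCol (Fin 1) g = 0 := by
      ext a b
      have := congrFun hg a
      simpa [Matrix.mul_apply, mul_comm] using this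
    have h0 := hcoef (Matrix.replicateCol (Fin 1) g)
    rw [Matrix.mul_assoc, hz] at h0
    simp only [Matrix.mul_zero, frobSq, Matrix.zero_apply, norm_zero, ne_eq, OfNat.ofNat_ne_zero,
      not_false_eq_true, zero_pow, Finset.sum_const_zero, mul_zero, Matrix.replicateCol_apply,
      Finset.univ_unique, Finset.sum_singleton] at h0
    intro i
    have := (Finset.sum_eq_zero_iff_of_nonneg (fun i _ => by positivity)).1
      (le_antisymm h0 (Finset.sum_nonneg fun i _ => by positivity)) i (Finset.mem_univ i)
    simpa using this
  have hQ := orthBasis_isometry X hind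
  obtain ⟨C, hC⟩ := exists_orthBasis_eq_mul X
  have hQd : frobSq (orthBasis X) = d := by
    have : ((frobSq (orthBasis X) : ℝ) : ℂ) = d := by
      rw [ofReal_frobSq, hQ, Matrix.trace_one, Fintype.card_fin]
    exact_mod_cast this
  -- The distance is the squared norm of the part of `orthBasis X` outside the range of `E`; below
  -- it factors as the lower block of `X` times the bounded matrix `C`.
  have hD : chordalDist (orthBasis X) E ^ 2 = frobSq (orthBasis X - E * (Eᴴ * orthBasis X)) := by
    rw [chordalDist_sq, frobSq_projection_sub_projection _ _ hQ hEE, Fintype.card_fin,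
      frobSq_sub_projection _ hEE, hQd]
  have hC4 : frobSq C ≤ 4 * d := by
    refine (hcoef C).trans ?_
    rw [Matrix.mul_assoc, ← hC, ← hQd]
    have h1 := frobSq_sub_projection E hEE (orthBasis X)
    have h2 := frobSq_nonneg (orthBasis X - E * (Eᴴ * orthBasis X))
    linarith
  have hfac : orthBasis X - E * (Eᴴ * orthBasis X) = (X - E * (Eᴴ * X)) * C := by
    rw [hC, Matrix.sub_mul]
    simp only [Matrix.mul_assoc]
  rw [hD, hfac]
  refine (frobSq_mul_le _ _).trans ?_
  calc frobSq (X - E * (Eᴴ * X)) * frobSq C ≤ (2 * d * d * ε ^ 2) * (4 * d) :=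
        mul_le_mul hbelow hC4 (frobSq_nonneg _) (by positivity)
    _ = 8 * d ^ 3 * ε ^ 2 := by ring

end GramSchmidt


/-! ### Small eigenvalues of the interference covariance -/

theorem eigenvalues₀_nonneg {N : ℕ} {A : Matrix (Fin N) (Fin N) ℂ} (hA : A.PosSemidef)
    (j : Fin (Fintype.card (Fin N))) : 0 ≤ hA.isHermitian.eigenvalues₀ j := by
  have := hA.eigenvalues_nonneg ((Fintype.equivOfCardEq (Fintype.card_fin _)) j)
  simpa [Matrix.IsHermitian.eigenvalues] using this

theorem ofReal_sum_norm_sq {N : ℕ} (v : Fin N → ℂ) :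
    ((∑ a, ‖v a‖ ^ 2 : ℝ) : ℂ) = star v ⬝ᵥ v := by
  push_cast
  simp [dotProduct, Complex.conj_mul']

/-- The kernel of a matrix with `d` rows contains a vector whose Rayleigh quotient is at least the
`(d + 1)`-st largest eigenvalue. -/
theorem exists_mulVec_eq_zero_eigenvalues₀_le {N d : ℕ} {A : Matrix (Fin N) (Fin N) ℂ}
    (hA : A.IsHermitian) (T : Matrix (Fin d) (Fin N) ℂ)
    (j : Fin (Fintype.card (Fin N))) (hj : (j : ℕ) = d) :
    ∃ v : Fin N → ℂ, 0 < ∑ a, ‖v a‖ ^ 2 ∧ T *ᵥ v = 0 ∧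
      hA.eigenvalues₀ j * ∑ a, ‖v a‖ ^ 2 ≤ (star v ⬝ᵥ A *ᵥ v).re := by
  have hjd : d + 1 ≤ Fintype.card (Fin N) := by have := j.2; omega
  let e : Fin (Fintype.card (Fin N)) ≃ Fin N := Fintype.equivOfCardEq (Fintype.card_fin _)
  let V : Fin (d + 1) → Fin N := fun k => e (Fin.castLE hjd k)
  have hVinj : Function.Injective V := e.injective.comp (Fin.castLE_injective hjd)
  let G : Matrix (Fin N) (Fin (d + 1)) ℂ := Matrix.of fun a k => hA.eigenvectorBasis (V k) a
  let ev : Fin (d + 1) → ℝ := fun k => hA.eigenvalues₀ (Fin.castLE hjd k)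
  have hG : Gᴴ * G = 1 := by
    rw [conjTranspose_mul_self_eq_one_iff]
    have : euclCol G = hA.eigenvectorBasis ∘ V := by ext k a; simp [euclCol, G]
    rw [this]
    exact hA.eigenvectorBasis.orthonormal.comp _ hVinj
  have hAG : A * G = G * Matrix.diagonal (fun k => (ev k : ℂ)) := by
    ext a k
    have h1 := congrFun (hA.mulVec_eigenvectorBasis (V k)) a
    have h2 : hA.eigenvalues (V k) = ev k := by
      simp [Matrix.IsHermitian.eigenvalues, ev, V, e]
    rw [h2] at h1
    rw [Matrix.mul_diagonal]
    simpa [G, Matrix.mul_apply, Matrix.mulVec, dotProduct, mul_comm] using h1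
  -- `T * G` has `d` rows and `d + 1` columns, so the kernel of `T` meets the span of the top `d +
  -- 1` eigenvectors nontrivially.
  obtain ⟨c, hc, hc0⟩ : ∃ c : Fin (d + 1) → ℂ, c ≠ 0 ∧ (T * G) *ᵥ c = 0 := by
    have := LinearMap.ker_ne_bot_of_finrank_lt (f := (T * G).mulVecLin) (by simp)
    obtain ⟨c, hc, hc0⟩ := (Submodule.ne_bot_iff _).1 this
    exact ⟨c, hc0, by simpa using hc⟩
  have hvc : ((∑ a, ‖(G *ᵥ c) a‖ ^ 2 : ℝ) : ℂ) = ((∑ k, ‖c k‖ ^ 2 : ℝ) : ℂ) := by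
    rw [ofReal_sum_norm_sq, ofReal_sum_norm_sq, Matrix.star_mulVec, Matrix.dotProduct_mulVec,
      Matrix.vecMul_vecMul, hG, Matrix.vecMul_one]
  have hvc' : ∑ a, ‖(G *ᵥ c) a‖ ^ 2 = ∑ k, ‖c k‖ ^ 2 := by exact_mod_cast hvc
  have hray : star (G *ᵥ c) ⬝ᵥ A *ᵥ (G *ᵥ c) = ((∑ k, ev k * ‖c k‖ ^ 2 : ℝ) : ℂ) := by
    rw [Matrix.mulVec_mulVec, hAG, ← Matrix.mulVec_mulVec, Matrix.star_mulVec,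
      Matrix.dotProduct_mulVec, Matrix.vecMul_vecMul, hG, Matrix.vecMul_one]
    push_cast
    simp only [dotProduct, Matrix.mulVec_diagonal, Pi.star_apply, ← Complex.conj_mul']
    refine Finset.sum_congr rfl fun k _ => ?_
    rw [RCLike.star_def]
    ring
  refine ⟨G *ᵥ c, ?_, ?_, ?_⟩
  · rw [hvc']
    obtain ⟨k, hk⟩ := Function.ne_iff.1 hc
    refine Finset.sum_pos' (fun i _ => by positivity) ⟨k, Finset.mem_univ k, ?_⟩
    have : 0 < ‖c k‖ := norm_pos_iff.2 hk
    positivity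
  · rw [Matrix.mulVec_mulVec, hc0]
  · rw [hray, Complex.ofReal_re, hvc', Finset.mul_sum]
    refine Finset.sum_le_sum fun k _ => ?_
    gcongr
    refine hA.eigenvalues₀_antitone ?_
    rw [Fin.le_def, hj]
    have := k.2
    simp only [Fin.val_castLE]
    omega

theorem interferenceCov_posSemidef {d : ℕ} (Hp Hq : Matrix (Fin (2 * d)) (Fin d) ℂ) :
    (interferenceCov Hp Hq).PosSemidef :=
  (Matrix.posSemidef_self_mul_conjTranspose Hp).add (Matrix.posSemidef_self_mul_conjTranspose Hq)

/-- The `d` smallest eigenvalues of the interference covariance matrix are controlled by the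
chordal distance of the interference subspaces. -/
theorem eigenvalues₀_interferenceCov_le {d : ℕ} (Hp Hq : Matrix (Fin (2 * d)) (Fin d) ℂ)
    (hq : LinearIndependent ℂ (fun c : Fin d => fun a : Fin (2 * d) => Hq a c))
    (hR : (interferenceCov Hp Hq).IsHermitian)
    (j : Fin (Fintype.card (Fin (2 * d)))) (hj : d ≤ (j : ℕ)) :
    hR.eigenvalues₀ j ≤ 2 * frobSq Hq * chordalDist (orthBasis Hp) (orthBasis Hq) ^ 2 := by
  have hd : d < Fintype.card (Fin (2 * d)) := lt_of_le_of_lt hj j.2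
  obtain ⟨v, hv, hv0, hle⟩ :=
    exists_mulVec_eq_zero_eigenvalues₀_le hR Hpᴴ ⟨d, hd⟩ rfl
  refine (hR.eigenvalues₀_antitone (show (⟨d, hd⟩ : Fin _) ≤ j from hj)).trans ?_
  refine le_of_mul_le_mul_right (hle.trans ?_) hv
  have hPv : (orthBasis Hp * (orthBasis Hp)ᴴ) *ᵥ v = 0 := by
    obtain ⟨C, hC⟩ := exists_orthBasis_eq_mul Hp
    have : (orthBasis Hp)ᴴ *ᵥ v = 0 := by
      rw [hC, Matrix.conjTranspose_mul, ← Matrix.mulVec_mulVec, hv0, Matrix.mulVec_zero]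
    rw [← Matrix.mulVec_mulVec, this, Matrix.mulVec_zero]
  -- Since `Hpᴴ` kills `v`, so does the projection onto the span of `Hp`. Inserting the projection
  -- onto the span of `Hq` in front of `v` then leaves only the difference of the two projections.
  have hHq : Hqᴴ *ᵥ v = -(Hqᴴ *ᵥ ((orthBasis Hp * (orthBasis Hp)ᴴ -
      orthBasis Hq * (orthBasis Hq)ᴴ) *ᵥ v)) := by
    have h1 : Hqᴴ = Hqᴴ * (orthBasis Hq * (orthBasis Hq)ᴴ) := by
      have := congrArg Matrix.conjTranspose (orthBasis_projection_mul_self Hq hq)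
      simpa only [Matrix.conjTranspose_mul, Matrix.conjTranspose_conjTranspose] using this.symm
    rw [Matrix.sub_mulVec, hPv, zero_sub, Matrix.mulVec_neg, neg_neg, Matrix.mulVec_mulVec, ← h1]
  have hray : (star v ⬝ᵥ interferenceCov Hp Hq *ᵥ v).re = ∑ b, ‖(Hqᴴ *ᵥ v) b‖ ^ 2 := by
    have : star v ⬝ᵥ interferenceCov Hp Hq *ᵥ v = ((∑ b, ‖(Hqᴴ *ᵥ v) b‖ ^ 2 : ℝ) : ℂ) := by
      rw [ofReal_sum_norm_sq, interferenceCov, Matrix.add_mulVec, ← Matrix.mulVec_mulVec, hv0,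
        Matrix.mulVec_zero, zero_add, Matrix.star_mulVec, Matrix.conjTranspose_conjTranspose,
        ← Matrix.mulVec_mulVec, Matrix.dotProduct_mulVec]
    rw [this, Complex.ofReal_re]
  rw [hray, hHq]
  simp only [Pi.neg_apply, norm_neg]
  refine (sum_norm_sq_mulVec_le _ _).trans ?_
  rw [frobSq_conjTranspose, chordalDist_sq]
  have h2 := sum_norm_sq_mulVec_le (orthBasis Hp * (orthBasis Hp)ᴴ -
      orthBasis Hq * (orthBasis Hq)ᴴ) v
  have h3 := mul_le_mul_of_nonneg_left h2 (frobSq_nonneg Hq)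
  linarith

/-! ### Determinant inequalities for positive semidefinite matrices -/

theorem isHermitian_one_add {n : Type*} [DecidableEq n] {B : Matrix n n ℂ} (hB : B.PosSemidef) :
    (1 + B).IsHermitian :=
  Matrix.isHermitian_one.add hB.isHermitian

section LogDet

variable {n : Type*} [Fintype n] [DecidableEq n]

theorem one_le_eigenvalues_one_add {B : Matrix n n ℂ} (hB : B.PosSemidef)
    (h : (1 + B).IsHermitian) (i : n) : 1 ≤ h.eigenvalues i := by
  rw [h.eigenvalues_eq, Matrix.add_mulVec, Matrix.one_mulVec, dotProduct_add, map_add]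
  have h1 : star (⇑(h.eigenvectorBasis i)) ⬝ᵥ (h.eigenvectorBasis i : n → ℂ) = 1 := by
    rw [dotProduct_comm, ← EuclideanSpace.inner_eq_star_dotProduct, inner_self_eq_norm_sq_to_K,
      h.eigenvectorBasis.orthonormal.1 i]
    simp
  rw [h1]
  have h2 := (RCLike.nonneg_iff.1 (hB.dotProduct_mulVec_nonneg (h.eigenvectorBasis i))).1
  simpa using h2

theorem det_one_add_posSemidef_eq {B : Matrix n n ℂ} (hB : B.PosSemidef) :
    (1 + B).det = ((∏ i, (isHermitian_one_add hB).eigenvalues i : ℝ) : ℂ) := by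
  rw [(isHermitian_one_add hB).det_eq_prod_eigenvalues]
  push_cast
  rfl

theorem ofReal_det_one_add_re {B : Matrix n n ℂ} (hB : B.PosSemidef) :
    (((1 + B).det.re : ℝ) : ℂ) = (1 + B).det := by
  rw [det_one_add_posSemidef_eq hB, Complex.ofReal_re]

theorem one_le_det_one_add_re {B : Matrix n n ℂ} (hB : B.PosSemidef) : 1 ≤ (1 + B).det.re := by
  rw [det_one_add_posSemidef_eq hB, Complex.ofReal_re]
  exact Finset.one_le_prod fun i _ => one_le_eigenvalues_one_add hB _ i

/-- This is `log x ≤ x - 1`, summed over the eigenvalues of `1 + B`. -/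
theorem log_det_one_add_re_le {B : Matrix n n ℂ} (hB : B.PosSemidef) :
    Real.log (1 + B).det.re ≤ B.trace.re := by
  have hH := isHermitian_one_add hB
  have htr : B.trace = ((∑ i, (hH.eigenvalues i - 1) : ℝ) : ℂ) := by
    have := hH.trace_eq_sum_eigenvalues
    rw [Matrix.trace_add, Matrix.trace_one] at this
    push_cast
    rw [Finset.sum_sub_distrib]
    simp only [Finset.sum_const, Finset.card_univ, nsmul_eq_mul, mul_one]
    exact eq_sub_of_add_eq' this
  rw [det_one_add_posSemidef_eq hB, htr, Complex.ofReal_re, Complex.ofReal_re, Real.log_prod]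
  · exact Finset.sum_le_sum fun i _ => Real.log_le_sub_one_of_pos
      (one_pos.trans_le (one_le_eigenvalues_one_add hB _ i))
  · exact fun i _ => (one_pos.trans_le (one_le_eigenvalues_one_add hB _ i)).ne'

open scoped MatrixOrder in
theorem exists_eq_conjTranspose_mul_self {A : Matrix n n ℂ} (hA : A.PosSemidef) :
    ∃ C : Matrix n n ℂ, A = Cᴴ * C :=
  CStarAlgebra.nonneg_iff_eq_star_mul_self.mp hA.nonneg

/-- With `A = Cᴴ * C` and `C` invertible, `A + B = Cᴴ * (1 + B') * C` for a positive semidefinite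
`B'`, and `1 + B'` has determinant at least one. -/
theorem det_re_le_det_add_re {A B : Matrix n n ℂ} (hA : A.PosDef) (hB : B.PosSemidef) :
    A.det.re ≤ (A + B).det.re := by
  obtain ⟨C, hC⟩ := exists_eq_conjTranspose_mul_self hA.posSemidef
  have hdet : A.det = ((‖C.det‖ ^ 2 : ℝ) : ℂ) := by
    rw [hC, Matrix.det_mul, Matrix.det_conjTranspose]
    push_cast
    rw [← Complex.conj_mul']
    rfl
  have hCdet : IsUnit C.det := by
    rw [isUnit_iff_ne_zero]
    intro h
    have := hA.det_pos
    rw [hdet, h] at this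
    simp at this
  have hCdet' : IsUnit Cᴴ.det := by
    rw [Matrix.det_conjTranspose]; exact hCdet.star
  set B' := (C⁻¹)ᴴ * B * C⁻¹ with hB'
  have hB'pos : B'.PosSemidef := hB.conjTranspose_mul_mul_same _
  have hAB : A + B = Cᴴ * (1 + B') * C := by
    rw [Matrix.mul_add, Matrix.add_mul, Matrix.mul_one, ← hC, hB', Matrix.conjTranspose_nonsing_inv]
    congr 1
    simp only [← Matrix.mul_assoc]
    rw [Matrix.mul_nonsing_inv _ hCdet', Matrix.one_mul, Matrix.mul_assoc,
      Matrix.nonsing_inv_mul _ hCdet, Matrix.mul_one]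
  have hdet2 : (A + B).det = ((‖C.det‖ ^ 2 * (1 + B').det.re : ℝ) : ℂ) := by
    rw [hAB, Matrix.det_mul, Matrix.det_mul, mul_right_comm, ← Matrix.det_mul, ← hC, hdet]
    push_cast
    rw [ofReal_det_one_add_re hB'pos]
  rw [hdet, hdet2, Complex.ofReal_re, Complex.ofReal_re]
  exact le_mul_of_one_le_right (by positivity) (one_le_det_one_add_re hB'pos)

end LogDet

/-! ### Rate loss through residual interference -/

theorem posSemidef_smul_mul_conjTranspose {m n : Type*} [Fintype m] [Fintype n] {p : ℝ} (hp : 0 ≤ p)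
    (G : Matrix m n ℂ) : ((p : ℂ) • (G * Gᴴ)).PosSemidef :=
  (Matrix.posSemidef_self_mul_conjTranspose G).smul (by exact_mod_cast hp)

theorem pointToPointRate_nonneg {d : ℕ} {P : ℝ} (hP : 0 ≤ P) (G : Matrix (Fin d) (Fin d) ℂ) :
    0 ≤ pointToPointRate d P G :=
  Real.logb_nonneg one_lt_two
    (one_le_det_one_add_re (posSemidef_smul_mul_conjTranspose (by positivity) G))

theorem pointToPointRate_le {d : ℕ} {P : ℝ} (hP : 0 ≤ P) (G : Matrix (Fin d) (Fin d) ℂ) :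
    pointToPointRate d P G ≤ P / d * frobSq G / Real.log 2 := by
  unfold pointToPointRate Real.logb
  have hlog : 0 < Real.log 2 := Real.log_pos one_lt_two
  gcongr
  refine (log_det_one_add_re_le (posSemidef_smul_mul_conjTranspose (by positivity) G)).trans_eq ?_
  rw [Matrix.trace_smul, Matrix.trace_mul_comm, ← ofReal_frobSq, smul_eq_mul, ← Complex.ofReal_mul,
    Complex.ofReal_re]

/-- With a postfilter that diagonalizes the interference covariance, interference costs at most the
trace of the filtered interference covariance. -/
theorem instRate_bounds {d : ℕ} {P : ℝ} (hP : 0 ≤ P) (Hd Hp Hq U : Matrix (Fin (2 * d)) (Fin d) ℂ)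
    (ev : Fin d → ℝ) (hev : ∀ n, 0 ≤ ev n)
    (hU : Uᴴ * interferenceCov Hp Hq * U = Matrix.diagonal fun n => (ev n : ℂ)) :
    0 ≤ instRate P Hd Hp Hq U ∧ instRate P Hd Hp Hq U ≤ pointToPointRate d P (Uᴴ * Hd) ∧
      pointToPointRate d P (Uᴴ * Hd) ≤
        instRate P Hd Hp Hq U + (∑ n, P / d * ev n) / Real.log 2 := by
  obtain ⟨p, hpdef⟩ : ∃ p : ℝ, p = P / d := ⟨_, rfl⟩
  have hp : 0 ≤ p := by rw [hpdef]; positivity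
  obtain ⟨S, hS⟩ : ∃ S : Matrix (Fin d) (Fin d) ℂ, S = Uᴴ * Hd := ⟨_, rfl⟩
  have hx : ∀ n, 0 < 1 + p * ev n := fun n => by have := mul_nonneg hp (hev n); linarith
  -- `T = diagonal t` is the inverse square root of the filtered noise-plus-interference covariance.
  -- Whitening by `T` turns the rate into the interference-free rate of `T * S`.
  let t : Fin d → ℝ := fun n => (√(1 + p * ev n))⁻¹
  have ht : ∀ n, 0 < t n := fun n => inv_pos.2 (Real.sqrt_pos.2 (hx n))
  have htsq : ∀ n, t n * t n = (1 + p * ev n)⁻¹ := fun n => by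
    simp only [t]; rw [← mul_inv, Real.mul_self_sqrt (hx n).le]
  have htsq1 : ∀ n, t n * t n ≤ 1 := fun n => by
    rw [htsq]; exact inv_le_one_of_one_le₀ (by have := mul_nonneg hp (hev n); linarith)
  obtain ⟨T, hT⟩ : ∃ T : Matrix (Fin d) (Fin d) ℂ, T = Matrix.diagonal fun n => (t n : ℂ) :=
    ⟨_, rfl⟩
  have hTH : Tᴴ = T := by
    rw [hT, Matrix.diagonal_conjTranspose]; congr 1; ext n; simp
  have hTT : T * T = Matrix.diagonal fun n => (((1 + p * ev n)⁻¹ : ℝ) : ℂ) := by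
    rw [hT, Matrix.diagonal_mul_diagonal]
    congr 1; ext n
    rw [← Complex.ofReal_mul, htsq]
  have hM : ((p : ℂ) • (Uᴴ * Hp * Hpᴴ * U + Uᴴ * Hq * Hqᴴ * U) + 1) =
      Matrix.diagonal fun n => ((1 + p * ev n : ℝ) : ℂ) := by
    have : Uᴴ * Hp * Hpᴴ * U + Uᴴ * Hq * Hqᴴ * U = Uᴴ * interferenceCov Hp Hq * U := by
      simp only [interferenceCov, Matrix.mul_add, Matrix.add_mul, Matrix.mul_assoc]
    rw [this, hU, ← Matrix.diagonal_smul, ← Matrix.diagonal_one, Matrix.diagonal_add]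
    congr 1; ext n
    simp [add_comm]
  have hMinv : (Matrix.diagonal fun n => ((1 + p * ev n : ℝ) : ℂ))⁻¹ = T * T := by
    refine Matrix.inv_eq_right_inv ?_
    rw [hTT, Matrix.diagonal_mul_diagonal, ← Matrix.diagonal_one]
    congr 1; ext n
    rw [← Complex.ofReal_mul, mul_inv_cancel₀ (hx n).ne', Complex.ofReal_one]
  have hrate : instRate P Hd Hp Hq U = pointToPointRate d P (T * S) := by
    unfold instRate pointToPointRate
    rw [← hpdef, hM, hMinv, ← Matrix.mul_assoc, Matrix.det_one_add_mul_comm]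
    congr 4
    rw [Matrix.conjTranspose_mul, hTH, hS, Matrix.conjTranspose_mul,
      Matrix.conjTranspose_conjTranspose]
    simp only [Matrix.mul_smul, Matrix.smul_mul, Matrix.mul_assoc]
  have hpos : 1 ≤ (1 + (p : ℂ) • (T * S * (T * S)ᴴ)).det.re :=
    one_le_det_one_add_re (posSemidef_smul_mul_conjTranspose hp (T * S))
  have hpos' : 1 ≤ (1 + (p : ℂ) • (S * Sᴴ)).det.re :=
    one_le_det_one_add_re (posSemidef_smul_mul_conjTranspose hp S)
  rw [← hS, hrate]
  refine ⟨pointToPointRate_nonneg hP _, ?_, ?_⟩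
  · unfold pointToPointRate
    rw [← hpdef]
    refine Real.logb_le_logb_of_le one_lt_two (by linarith) ?_
    have e1 : (1 + (p : ℂ) • (T * S * (T * S)ᴴ)).det = (1 + (p : ℂ) • ((T * S)ᴴ * (T * S))).det := by
      rw [← Matrix.smul_mul, Matrix.det_one_add_mul_comm, Matrix.mul_smul]
    have e2 : (1 + (p : ℂ) • (S * Sᴴ)).det = (1 + (p : ℂ) • (Sᴴ * S)).det := by
      rw [← Matrix.smul_mul, Matrix.det_one_add_mul_comm, Matrix.mul_smul]
    -- Whitening only shrinks the signal: `1 - T * T` is positive semidefinite because the noise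
    -- alone has unit covariance.
    have e3 : (1 + (p : ℂ) • (Sᴴ * S)) = (1 + (p : ℂ) • ((T * S)ᴴ * (T * S))) +
        (p : ℂ) • (Sᴴ * (1 - T * T) * S) := by
      rw [Matrix.conjTranspose_mul, hTH, add_assoc, ← smul_add]
      congr 2
      rw [Matrix.mul_sub, Matrix.sub_mul, Matrix.mul_one]
      simp only [Matrix.mul_assoc]
      abel
    rw [e1, e2, e3]
    refine det_re_le_det_add_re ?_ ?_
    · refine Matrix.PosDef.one.add_posSemidef ?_
      exact (Matrix.posSemidef_conjTranspose_mul_self (T * S)).smul (by exact_mod_cast hp)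
    · refine Matrix.PosSemidef.smul (Matrix.PosSemidef.conjTranspose_mul_mul_same ?_ S)
        (by exact_mod_cast hp)
      rw [hTT, ← Matrix.diagonal_one, Matrix.diagonal_sub]
      refine Matrix.PosSemidef.diagonal fun n => ?_
      have := htsq1 n
      rw [htsq] at this
      rw [Pi.zero_apply, ← Complex.ofReal_one, ← Complex.ofReal_sub]
      exact Complex.zero_le_real.2 (sub_nonneg.2 this)
  · unfold pointToPointRate
    rw [← hpdef]
    have hprod : 0 < ∏ n, (1 + p * ev n) := Finset.prod_pos fun n _ => hx n
    -- Adding the diagonal interference term can only increase the determinant; the enlarged matrix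
    -- then has determinant equal to that of the whitened channel times that of the
    -- noise-plus-interference covariance.
    have hdet : (1 + (p : ℂ) • (S * Sᴴ)).det.re ≤
        (1 + (p : ℂ) • (T * S * (T * S)ᴴ)).det.re * ∏ n, (1 + p * ev n) := by
      have f1 : (1 + (p : ℂ) • (S * Sᴴ) + Matrix.diagonal fun n => ((p * ev n : ℝ) : ℂ)).det =
          (((1 + (p : ℂ) • (T * S * (T * S)ᴴ)).det.re * ∏ n, (1 + p * ev n) : ℝ) : ℂ) := by
        push_cast
        rw [ofReal_det_one_add_re (posSemidef_smul_mul_conjTranspose hp (T * S))]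
        have f2 : ∏ n, (1 + (p : ℂ) * (ev n : ℂ)) =
            (Matrix.diagonal fun n => ((1 + p * ev n : ℝ) : ℂ)).det := by
          rw [Matrix.det_diagonal]; push_cast; rfl
        have f3 : (1 + (p : ℂ) • (T * S * (T * S)ᴴ)).det = (1 + (p : ℂ) • (S * Sᴴ) * (T * T)).det := by
          rw [← Matrix.mul_assoc, Matrix.det_one_add_mul_comm, Matrix.conjTranspose_mul, hTH]
          simp only [Matrix.mul_smul, Matrix.smul_mul, Matrix.mul_assoc]
        have f4 : (T * T) * (Matrix.diagonal fun n => ((1 + p * ev n : ℝ) : ℂ)) = 1 := by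
          rw [hTT, Matrix.diagonal_mul_diagonal, ← Matrix.diagonal_one]
          congr 1; ext n
          rw [← Complex.ofReal_mul, inv_mul_cancel₀ (hx n).ne', Complex.ofReal_one]
        rw [f2, f3, ← Matrix.det_mul, Matrix.add_mul, Matrix.mul_assoc, f4, Matrix.one_mul,
          Matrix.mul_one, add_right_comm, add_comm _ ((p : ℂ) • _), add_comm _ ((p : ℂ) • _)]
        congr 2
        rw [← Matrix.diagonal_one, Matrix.diagonal_add]
        congr 1; ext n
        push_cast; rfl
      have f5 := det_re_le_det_add_re
        (Matrix.PosDef.one.add_posSemidef (posSemidef_smul_mul_conjTranspose hp S))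
        (Matrix.PosSemidef.diagonal (n := Fin d) (d := fun n => ((p * ev n : ℝ) : ℂ)) fun n => by
          rw [Pi.zero_apply]
          exact Complex.zero_le_real.2 (mul_nonneg hp (hev n)))
      rwa [f1, Complex.ofReal_re] at f5
    have hlog : 0 < Real.log 2 := Real.log_pos one_lt_two
    unfold Real.logb
    rw [← add_div]
    gcongr
    calc Real.log (1 + (p : ℂ) • (S * Sᴴ)).det.re
        ≤ Real.log ((1 + (p : ℂ) • (T * S * (T * S)ᴴ)).det.re * ∏ n, (1 + p * ev n)) :=
          Real.log_le_log (by linarith) hdet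
      _ = Real.log (1 + (p : ℂ) • (T * S * (T * S)ᴴ)).det.re + ∑ n, Real.log (1 + p * ev n) := by
          rw [Real.log_mul (by linarith) hprod.ne', Real.log_prod fun n _ => (hx n).ne']
      _ ≤ _ := by
          gcongr with n
          have := Real.log_le_sub_one_of_pos (hx n)
          linarith

/-- The loss of rate of a user through residual interference, in terms of the chordal distance. -/
theorem instRate_postfilter_bounds {d : ℕ} {P : ℝ} (hP : 0 ≤ P)
    (u : Matrix (Fin (2 * d)) (Fin (2 * d)) ℂ → Matrix (Fin (2 * d)) (Fin d) ℂ)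
    (hu : IsPostfilter d u) (Hd Hp Hq : Matrix (Fin (2 * d)) (Fin d) ℂ) :
    0 ≤ instRate P Hd Hp Hq (u (interferenceCov Hp Hq)) ∧
    instRate P Hd Hp Hq (u (interferenceCov Hp Hq)) ≤
      pointToPointRate d P ((u (interferenceCov Hp Hq))ᴴ * Hd) ∧
    (LinearIndependent ℂ (fun c : Fin d => fun a : Fin (2 * d) => Hq a c) →
      pointToPointRate d P ((u (interferenceCov Hp Hq))ᴴ * Hd) ≤
        instRate P Hd Hp Hq (u (interferenceCov Hp Hq)) +
          2 / Real.log 2 * P * frobSq Hq * chordalDist (orthBasis Hp) (orthBasis Hq) ^ 2) := by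
  have hR := interferenceCov_posSemidef Hp Hq
  obtain ⟨U, hUdef⟩ : ∃ U, U = u (interferenceCov Hp Hq) := ⟨_, rfl⟩
  have hUU : Uᴴ * U = 1 := by rw [hUdef]; exact hu.orthonormal _ hR
  rw [← hUdef]
  have hlt : ∀ n : Fin d, d + (n : ℕ) < Fintype.card (Fin (2 * d)) := fun n => by
    rw [Fintype.card_fin]; have := n.isLt; omega
  let ev : Fin d → ℝ := fun n => hR.isHermitian.eigenvalues₀ ⟨d + n, hlt n⟩
  have hRU : interferenceCov Hp Hq * U = U * Matrix.diagonal fun n => (ev n : ℂ) := by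
    ext a n
    have := congrFun (hu.singular _ hR n) a
    rw [← hUdef] at this
    rw [Matrix.mul_diagonal]
    simpa [Matrix.mul_apply, Matrix.mulVec, dotProduct, mul_comm, ev] using this
  have hU : Uᴴ * interferenceCov Hp Hq * U = Matrix.diagonal fun n => (ev n : ℂ) := by
    rw [Matrix.mul_assoc, hRU, ← Matrix.mul_assoc, hUU, Matrix.one_mul]
  obtain ⟨h1, h2, h3⟩ := instRate_bounds hP Hd Hp Hq U ev (fun n => eigenvalues₀_nonneg hR _) hU
  refine ⟨h1, h2, fun hq => h3.trans ?_⟩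
  have hlog : 0 < Real.log 2 := Real.log_pos one_lt_two
  have hev : ∀ n, ev n ≤ 2 * frobSq Hq * chordalDist (orthBasis Hp) (orthBasis Hq) ^ 2 := fun n =>
    eigenvalues₀_interferenceCov_le Hp Hq hq hR.isHermitian _ (Nat.le_add_right _ _)
  obtain ⟨E, hE⟩ : ∃ E, E = 2 * frobSq Hq * chordalDist (orthBasis Hp) (orthBasis Hq) ^ 2 := ⟨_, rfl⟩
  have hE0 : 0 ≤ E := by rw [hE]; have := frobSq_nonneg Hq; positivity
  have hsum : ∑ n, P / d * ev n ≤ P * E := by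
    calc ∑ n, P / d * ev n ≤ ∑ _n : Fin d, P / d * E := by
          gcongr with n; rw [hE]; exact hev n
      _ = d * (P / d) * E := by simp [mul_assoc]
      _ ≤ P * E := by
          gcongr
          rcases Nat.eq_zero_or_pos d with h | h
          · subst h; simpa using hP
          · have : (d : ℝ) ≠ 0 := by exact_mod_cast h.ne'
            rw [mul_div_cancel₀ _ this]
  have : (∑ n, P / d * ev n) / Real.log 2 ≤ P * E / Real.log 2 := by gcongr
  refine add_le_add le_rfl (this.trans_eq ?_)
  rw [hE]; ring


/-! ### Measurability of matrix expressions -/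

section MatrixMeasurability

variable {α : Type*} [MeasurableSpace α]

/-- Entrywise measurability of a matrix-valued function. -/
def EntrywiseMeasurable {ι κ : Type*} (f : α → Matrix ι κ ℂ) : Prop :=
  ∀ a b, Measurable fun x => f x a b

namespace EntrywiseMeasurable

variable {ι κ σ : Type*}

theorem mul [Fintype κ] {f : α → Matrix ι κ ℂ} {g : α → Matrix κ σ ℂ} (hf : EntrywiseMeasurable f)
    (hg : EntrywiseMeasurable g) : EntrywiseMeasurable fun x => f x * g x := fun a b => by
  simp only [Matrix.mul_apply]
  exact Finset.measurable_fun_sum _ fun c _ => (hf a c).mul (hg c b)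

theorem add {f g : α → Matrix ι κ ℂ} (hf : EntrywiseMeasurable f)
    (hg : EntrywiseMeasurable g) : EntrywiseMeasurable fun x => f x + g x := fun a b =>
  (hf a b).add (hg a b)

theorem sub {f g : α → Matrix ι κ ℂ} (hf : EntrywiseMeasurable f)
    (hg : EntrywiseMeasurable g) : EntrywiseMeasurable fun x => f x - g x := fun a b =>
  (hf a b).sub (hg a b)

theorem smul {f : α → Matrix ι κ ℂ} {c : α → ℂ} (hc : Measurable c) (hf : EntrywiseMeasurable f) :
    EntrywiseMeasurable fun x => c x • f x := fun a b => hc.mul (hf a b)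

theorem const (A : Matrix ι κ ℂ) : EntrywiseMeasurable fun _ : α => A := fun _ _ =>
  measurable_const

theorem conjTranspose {f : α → Matrix ι κ ℂ} (hf : EntrywiseMeasurable f) :
    EntrywiseMeasurable fun x => (f x)ᴴ := fun a b =>
  (Complex.continuous_conj.measurable).comp (hf b a)

theorem det [Fintype ι] [DecidableEq ι] {f : α → Matrix ι ι ℂ} (hf : EntrywiseMeasurable f) :
    Measurable fun x => (f x).det := by
  simp only [Matrix.det_apply]
  exact Finset.measurable_fun_sum _ fun c _ =>
    (Finset.measurable_fun_prod _ fun a _ => hf _ _).const_smul _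

/-- Cramer's rule: adjugate over determinant. The convention that the inverse of zero is zero makes
this formula valid at singular matrices too. -/
theorem inv [Fintype ι] [DecidableEq ι] {f : α → Matrix ι ι ℂ} (hf : EntrywiseMeasurable f) :
    EntrywiseMeasurable fun x => (f x)⁻¹ := by
  simp only [Matrix.inv_def, Ring.inverse_eq_inv']
  refine smul hf.det.inv fun a b => ?_
  simp only [Matrix.adjugate_apply]
  refine det fun c e => ?_
  by_cases h : c = b
  · subst h; simp
  · simpa [Matrix.updateRow_ne h] using hf c e

theorem frobSq [Fintype ι] [Fintype κ] {f : α → Matrix ι κ ℂ} (hf : EntrywiseMeasurable f) :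
    Measurable fun x => frobSq (f x) :=
  Finset.measurable_fun_sum _ fun a _ => Finset.measurable_fun_sum _ fun b _ =>
    (hf a b).norm.pow_const 2

end EntrywiseMeasurable

theorem EntrywiseMeasurable.pointToPointRate {d : ℕ} {f : α → Matrix (Fin d) (Fin d) ℂ} (P : ℝ)
    (hf : EntrywiseMeasurable f) : Measurable fun x => pointToPointRate d P (f x) := by
  have h1 : EntrywiseMeasurable fun x => 1 + ((P / d : ℝ) : ℂ) • (f x * (f x)ᴴ) :=
    (EntrywiseMeasurable.const _).add (.smul measurable_const (hf.mul hf.conjTranspose))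
  exact (Real.measurable_log.comp (Complex.measurable_re.comp h1.det)).div_const _

theorem EntrywiseMeasurable.interferenceCov {d : ℕ} {f g : α → Matrix (Fin (2 * d)) (Fin d) ℂ}
    (hf : EntrywiseMeasurable f) (hg : EntrywiseMeasurable g) :
    EntrywiseMeasurable fun x => interferenceCov (f x) (g x) :=
  (hf.mul hf.conjTranspose).add (hg.mul hg.conjTranspose)

theorem IsPostfilter.entrywiseMeasurable {d : ℕ}
    {u : Matrix (Fin (2 * d)) (Fin (2 * d)) ℂ → Matrix (Fin (2 * d)) (Fin d) ℂ}
    (hu : IsPostfilter d u) {f : α → Matrix (Fin (2 * d)) (Fin (2 * d)) ℂ}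
    (hf : EntrywiseMeasurable f) : EntrywiseMeasurable fun x => u (f x) := fun a b =>
  (hu.measurable a b).comp
    (measurable_pi_lambda _ fun c => measurable_pi_lambda _ fun e => hf c e)

theorem EntrywiseMeasurable.instRate {d : ℕ} {fd fp fq fu : α → Matrix (Fin (2 * d)) (Fin d) ℂ}
    (P : ℝ) (hd : EntrywiseMeasurable fd) (hp : EntrywiseMeasurable fp)
    (hq : EntrywiseMeasurable fq) (hu : EntrywiseMeasurable fu) :
    Measurable fun x => instRate P (fd x) (fp x) (fq x) (fu x) := by
  have h1 := (EntrywiseMeasurable.const (α := α) (1 : Matrix (Fin d) (Fin d) ℂ)).add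
    ((EntrywiseMeasurable.smul (measurable_const (a := ((P / d : ℝ) : ℂ)))
      (((hu.conjTranspose.mul hd).mul hd.conjTranspose).mul hu)).mul
    (((EntrywiseMeasurable.smul (measurable_const (a := ((P / d : ℝ) : ℂ)))
      ((((hu.conjTranspose.mul hp).mul hp.conjTranspose).mul hu).add
        (((hu.conjTranspose.mul hq).mul hq.conjTranspose).mul hu))).add
      (EntrywiseMeasurable.const 1)).inv))
  exact (Real.measurable_log.comp (Complex.measurable_re.comp h1.det)).div_const _

open InnerProductSpace in
theorem measurable_gramSchmidt {m n : ℕ} {f : α → Fin n → EuclideanSpace ℂ (Fin m)}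
    (hf : ∀ i, Measurable fun x => f x i) (i : Fin n) :
    Measurable fun x => gramSchmidt ℂ (f x) i := by
  induction i using WellFoundedLT.induction with
  | ind i ih =>
    have h : ∀ x, gramSchmidt ℂ (f x) i = f x i - ∑ j ∈ Finset.Iio i,
        (inner ℂ (gramSchmidt ℂ (f x) j) (f x i) / (‖gramSchmidt ℂ (f x) j‖ : ℂ) ^ 2) •
          gramSchmidt ℂ (f x) j := fun x =>
      eq_sub_of_add_eq (gramSchmidt_def'' ℂ (f x) i).symm
    simp only [h]
    refine (hf i).sub (Finset.measurable_fun_sum _ fun j hj => ?_)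
    have hj' := ih j (Finset.mem_Iio.1 hj)
    exact ((hj'.inner (hf i)).div
      ((Complex.measurable_ofReal.comp hj'.norm).pow_const 2)).smul hj'

open InnerProductSpace in
theorem EntrywiseMeasurable.orthBasis {m n : ℕ} {f : α → Matrix (Fin m) (Fin n) ℂ}
    (hf : EntrywiseMeasurable f) : EntrywiseMeasurable fun x => orthBasis (f x) := by
  intro a b
  have hcol : ∀ c, Measurable fun x => euclCol (f x) c := fun c =>
    (WithLp.measurable_toLp 2 (Fin m → ℂ)).comp (measurable_pi_lambda _ fun a => hf a c)
  have h1 := measurable_gramSchmidt hcol b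
  have h2 : Measurable fun x => gramSchmidtNormed ℂ (euclCol (f x)) b :=
    (Complex.measurable_ofReal.comp h1.norm).inv.smul h1
  exact (measurable_pi_apply a).comp ((WithLp.measurable_ofLp 2 (Fin m → ℂ)).comp h2)

theorem EntrywiseMeasurable.chordalDist_sq {m n : ℕ} {f g : α → Matrix (Fin m) (Fin n) ℂ}
    (hf : EntrywiseMeasurable f) (hg : EntrywiseMeasurable g) :
    Measurable fun x => chordalDist (f x) (g x) ^ 2 := by
  simp only [_root_.chordalDist_sq]
  exact ((hf.mul hf.conjTranspose).sub (hg.mul hg.conjTranspose)).frobSq.const_mul _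

theorem entrywiseMeasurable_of {m n : ℕ} {f : α → Fin m → Fin n → ℂ} (hf : Measurable f) :
    EntrywiseMeasurable fun x => Matrix.of (f x) := fun a b =>
  (measurable_pi_apply b).comp ((measurable_pi_apply a).comp hf)

end MatrixMeasurability

/-! ### Random subspaces: invariance, capacity and small-ball probability -/

/-- The squared chordal distance of the column spaces of two matrices. -/
def spanDist {m n : ℕ} (x y : Fin m → Fin n → ℂ) : ℝ :=
  chordalDist (orthBasis (Matrix.of x)) (orthBasis (Matrix.of y)) ^ 2

/-- The squared chordal distance of a column space to the span of the first basis vectors. -/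
def stdSpanDist {m n : ℕ} (x : Fin m → Fin n → ℂ) : ℝ :=
  chordalDist (orthBasis (Matrix.of x)) (stdFrame m n) ^ 2

theorem measurable_spanDist {m n : ℕ} :
    Measurable fun z : (Fin m → Fin n → ℂ) × (Fin m → Fin n → ℂ) => spanDist z.1 z.2 :=
  (entrywiseMeasurable_of measurable_fst).orthBasis.chordalDist_sq
    (entrywiseMeasurable_of measurable_snd).orthBasis

theorem Measurable.spanDist {α : Type*} [MeasurableSpace α] {m n : ℕ} {f g : α → Fin m → Fin n → ℂ}
    (hf : Measurable f) (hg : Measurable g) : Measurable fun x => spanDist (f x) (g x) :=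
  (entrywiseMeasurable_of hf).orthBasis.chordalDist_sq (entrywiseMeasurable_of hg).orthBasis

theorem measurable_stdSpanDist {m n : ℕ} :
    Measurable (stdSpanDist : (Fin m → Fin n → ℂ) → ℝ) :=
  (entrywiseMeasurable_of measurable_id).orthBasis.chordalDist_sq (EntrywiseMeasurable.const _)

/-- A unitary `W` moves the standard frame to the orthonormal basis obtained from `y`. Applying `Wᴴ`
to both arguments keeps the distance and the law of `x`, so the law of the distance does not depend
on `y`. -/
theorem map_spanDist_iidGaussian {m n : ℕ} (hnm : n ≤ m) (y : Fin m → Fin n → ℂ)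
    (hy : LinearIndependent ℂ (fun c : Fin n => fun a : Fin m => y a c)) :
    (iidGaussian m n).map (fun x => spanDist x y) = (iidGaussian m n).map stdSpanDist := by
  obtain ⟨W, hW, hWE⟩ := exists_unitary_mul_stdFrame hnm _ (orthBasis_isometry (Matrix.of y) hy)
  have hW' : W * Wᴴ = 1 := mul_eq_one_comm.1 hW
  have hWH : Wᴴᴴ * Wᴴ = 1 := by rw [Matrix.conjTranspose_conjTranspose]; exact hW'
  have h : ∀ x : Fin m → Fin n → ℂ,
      spanDist x y = stdSpanDist (Matrix.of.symm (Wᴴ * Matrix.of x)) := by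
    intro x
    unfold spanDist stdSpanDist
    rw [Equiv.apply_symm_apply, orthBasis_mul_unitary _ hWH,
      ← chordalDist_mul_unitary W hW (Wᴴ * _) (stdFrame m n), hWE, ← Matrix.mul_assoc, hW',
      Matrix.one_mul]
  have hmeas : Measurable fun x : Fin m → Fin n → ℂ => Matrix.of.symm (Wᴴ * Matrix.of x) :=
    measurable_pi_lambda _ fun a => measurable_pi_lambda _ fun b =>
      (EntrywiseMeasurable.const Wᴴ).mul (entrywiseMeasurable_of measurable_id) a b
  have hc : (fun x => spanDist x y) =
      stdSpanDist ∘ fun x : Fin m → Fin n → ℂ => Matrix.of.symm (Wᴴ * Matrix.of x) := funext h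
  rw [hc, ← Measure.map_map measurable_stdSpanDist hmeas, map_mul_iidGaussian Wᴴ (by
    rw [Matrix.conjTranspose_conjTranspose]; exact hW)]

/-- The distance of two independent uniform subspaces is independent of the second matrix. -/
theorem map_spanDist_prod_iidGaussian {m n : ℕ} (hnm : n ≤ m) :
    ((iidGaussian m n).prod (iidGaussian m n)).map (fun z => (spanDist z.1 z.2, z.2)) =
      ((iidGaussian m n).map stdSpanDist).prod (iidGaussian m n) := by
  have : IsProbabilityMeasure ((iidGaussian m n).map stdSpanDist) :=
    Measure.isProbabilityMeasure_map measurable_stdSpanDist.aemeasurable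
  refine (Measure.prod_eq fun s t hs ht => ?_).symm
  have hm : Measurable fun z : (Fin m → Fin n → ℂ) × (Fin m → Fin n → ℂ) =>
      (spanDist z.1 z.2, z.2) := measurable_spanDist.prodMk measurable_snd
  rw [Measure.map_apply hm (hs.prod ht), Measure.prod_apply_symm (hm (hs.prod ht)),
    ← lintegral_indicator_one ht, ← lintegral_const_mul _ (measurable_one.indicator ht)]
  refine lintegral_congr_ae ?_
  filter_upwards [ae_linearIndependent_iidGaussian hnm] with y hy
  by_cases hyt : y ∈ t
  · have : (fun x => (x, y)) ⁻¹' ((fun z : (Fin m → Fin n → ℂ) × (Fin m → Fin n → ℂ) =>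
        (spanDist z.1 z.2, z.2)) ⁻¹' s ×ˢ t) = (fun x => spanDist x y) ⁻¹' s := by
      ext x; simp [hyt]
    have hmy : Measurable fun x : Fin m → Fin n → ℂ => spanDist x y :=
      (entrywiseMeasurable_of measurable_id).orthBasis.chordalDist_sq (EntrywiseMeasurable.const _)
    rw [this, ← Measure.map_apply hmy hs, map_spanDist_iidGaussian hnm y hy]
    simp [hyt]
  · have : (fun x => (x, y)) ⁻¹' ((fun z : (Fin m → Fin n → ℂ) × (Fin m → Fin n → ℂ) =>
        (spanDist z.1 z.2, z.2)) ⁻¹' s ×ˢ t) = ∅ := by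
      ext x; simp [hyt]
    simp [this, hyt]

theorem integrable_frobSq_iidGaussian {m n : ℕ} :
    Integrable (fun h => frobSq (Matrix.of h)) (iidGaussian m n) :=
  integrable_finsetSum _ fun a _ => integrable_finsetSum _ fun b _ =>
    integrable_normSq_apply_iidGaussian a b

theorem integrable_pointToPointRate {d : ℕ} {P : ℝ} (hP : 0 ≤ P) :
    Integrable (fun g => pointToPointRate d P (Matrix.of g)) (gaussianMatrixLaw d) := by
  have h1 : Integrable (fun g => P / d * frobSq (Matrix.of g) / Real.log 2) (gaussianMatrixLaw d) :=
    ((integrable_frobSq_iidGaussian (m := d) (n := d)).const_mul _).div_const _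
  refine h1.mono'
    ((entrywiseMeasurable_of measurable_id).pointToPointRate P).aestronglyMeasurable
    (ae_of_all _ fun g => ?_)
  rw [Real.norm_of_nonneg (pointToPointRate_nonneg hP _)]
  exact pointToPointRate_le hP _

/-- `Uᴴ` has orthonormal rows, so `Uᴴ * H` is a `d × d` matrix with i.i.d. Gaussian entries. -/
theorem integral_pointToPointRate_filtered {m d : ℕ} (P : ℝ) (U : Matrix (Fin m) (Fin d) ℂ)
    (hU : Uᴴ * U = 1) :
    ∫ h, pointToPointRate d P (Uᴴ * Matrix.of h) ∂(iidGaussian m d) = ergodicCapacity d P := by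
  have hmeas : Measurable fun x : Fin m → Fin d → ℂ => Matrix.of.symm (Uᴴ * Matrix.of x) :=
    measurable_pi_lambda _ fun a => measurable_pi_lambda _ fun b =>
      (EntrywiseMeasurable.const Uᴴ).mul (entrywiseMeasurable_of measurable_id) a b
  have h := map_mul_iidGaussian (n := d) Uᴴ
    (by rw [Matrix.conjTranspose_conjTranspose]; exact hU)
  change _ = ∫ g, pointToPointRate d P (Matrix.of g) ∂(iidGaussian d d)
  have hrate : Measurable fun g : Fin d → Fin d → ℂ => pointToPointRate d P (Matrix.of g) :=
    (entrywiseMeasurable_of measurable_id).pointToPointRate P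
  rw [← h, integral_map hmeas.aemeasurable hrate.aestronglyMeasurable]
  rfl

/-- Small balls in the Grassmannian have probability at least of order `x ^ (d ^ 2)`. -/
theorem exists_le_iidGaussian_stdSpanDist_lt {d : ℕ} (hd : 1 ≤ d) :
    ∃ c > 0, ∀ x : ℝ, 0 < x → x ≤ 1 → ENNReal.ofReal (c * x ^ (d ^ 2)) ≤
      iidGaussian (2 * d) d {h | stdSpanDist h < x} := by
  obtain ⟨c, hc, hball⟩ := exists_le_stdComplexGaussian_ball
  have hd0 : (1 : ℝ) ≤ d := by exact_mod_cast hd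
  refine ⟨(c * (1 / (2 * d)) ^ 2) ^ (d ^ 2) * (c * (1 / (16 * d ^ 3))) ^ (d ^ 2), by positivity,
    fun x hx hx1 => ?_⟩
  -- This choice makes the deterministic bound `8 * d ^ 3 * ε ^ 2` equal to `x / 2`.
  obtain ⟨ε, hε⟩ : ∃ ε, ε = √(x / (16 * d ^ 3)) := ⟨_, rfl⟩
  have hε0 : 0 < ε := by rw [hε]; positivity
  have hεsq : ε ^ 2 = x / (16 * d ^ 3) := by rw [hε, Real.sq_sqrt (by positivity)]
  have hε1 : ε ≤ 1 := by
    have h3 : (1 : ℝ) ≤ (d : ℝ) ^ 3 := one_le_pow₀ hd0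
    have : ε ^ 2 ≤ 1 := by
      rw [hεsq, div_le_one (by positivity)]; linarith
    nlinarith
  have hr1 : 1 / (2 * d : ℝ) ≤ 1 := by
    rw [div_le_one (by positivity)]; linarith
  -- The `d ^ 2` entries of the upper block need only a fixed tolerance. The `d ^ 2` entries of the
  -- lower block need tolerance `ε`, at probability of order `ε ^ 2` each, that is of order `x`;
  -- this is the source of the exponent `d ^ 2`.
  let r : ℕ → ℝ := fun a => if a < d then 1 / (2 * d) else ε
  have hr0 : ∀ a, 0 < r a := fun a => by
    simp only [r]; split_ifs <;> positivity
  have hrle : ∀ a, r a ≤ 1 := fun a => by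
    simp only [r]; split_ifs <;> assumption
  have hsub : Set.univ.pi (fun a : Fin (2 * d) => Set.univ.pi fun b : Fin d =>
      Metric.ball (stdFrame (2 * d) d a b) (r a)) ⊆ {h | stdSpanDist h < x} := by
    intro h hh
    simp only [Set.mem_univ_pi, Metric.mem_ball, dist_eq_norm] at hh
    refine (chordalDist_orthBasis_stdFrame_sq_le (ε := ε) (Matrix.of h) ?_ ?_).trans_lt ?_
    · intro a b ha
      have := hh a b
      simp only [r, ha, if_true] at this
      exact this.le
    · intro a b ha
      have := hh a b
      have hne : ¬ (a : ℕ) = b := by have := b.2; omega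
      simp only [r, not_lt.2 ha, if_false, stdFrame, Matrix.of_apply, hne, sub_zero] at this
      exact this.le
    · rw [hεsq]
      field_simp
      nlinarith
  refine le_trans ?_ (measure_mono hsub)
  unfold iidGaussian
  rw [Measure.pi_pi]
  simp only [Measure.pi_pi]
  calc ENNReal.ofReal ((c * (1 / (2 * d)) ^ 2) ^ (d ^ 2) * (c * (1 / (16 * d ^ 3))) ^ (d ^ 2) *
        x ^ (d ^ 2))
      = ∏ a : Fin (2 * d), ∏ _b : Fin d, ENNReal.ofReal (c * r a ^ 2) := by
        simp only [Finset.prod_const, Finset.card_univ, Fintype.card_fin]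
        rw [Finset.prod_range (fun a => ENNReal.ofReal (c * r a ^ 2) ^ d) |>.symm,
          show 2 * d = d + d from two_mul d, Finset.prod_range_add]
        have e1 : ∏ a ∈ Finset.range d, ENNReal.ofReal (c * r a ^ 2) ^ d =
            ENNReal.ofReal ((c * (1 / (2 * d)) ^ 2) ^ (d ^ 2)) := by
          rw [Finset.prod_congr rfl (g := fun _ => ENNReal.ofReal (c * (1 / (2 * d)) ^ 2) ^ d)]
          · rw [Finset.prod_const, Finset.card_range, ← pow_mul, ← sq,
              ENNReal.ofReal_pow (by positivity)]
          · intro a ha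
            simp only [r, Finset.mem_range.1 ha, if_true]
        have e2 : ∏ a ∈ Finset.range d, ENNReal.ofReal (c * r (d + a) ^ 2) ^ d =
            ENNReal.ofReal ((c * ε ^ 2) ^ (d ^ 2)) := by
          rw [Finset.prod_congr rfl (g := fun _ => ENNReal.ofReal (c * ε ^ 2) ^ d)]
          · rw [Finset.prod_const, Finset.card_range, ← pow_mul, ← sq,
              ENNReal.ofReal_pow (by positivity)]
          · intro a ha
            simp [r]
        rw [e1, e2, ← ENNReal.ofReal_mul (by positivity)]
        congr 1
        rw [mul_assoc, ← mul_pow]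
        congr 2
        rw [hεsq]; ring
    _ ≤ _ := by
        refine Finset.prod_le_prod' fun a _ => Finset.prod_le_prod' fun b _ => hball _ _ ?_ (hr0 _) (hrle _)
        simp only [stdFrame, Matrix.of_apply]
        split_ifs <;> simp


/-! ### Rearranging independent families -/

section Independence

variable {Ω : Type*} [MeasurableSpace Ω] {μ : Measure Ω}

/-- Independence means that the joint law is the infinite product of the marginals, and currying an
infinite product gives a product of products. -/
theorem iIndepFun_curry {ι κ E : Type*} [MeasurableSpace E] {f : ι × κ → Ω → E}
    (hf : ∀ p, Measurable (f p)) (h : iIndepFun f μ) :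
    iIndepFun (fun i ω j => f (i, j) ω) μ := by
  have := h.isProbabilityMeasure
  have hp : ∀ p, IsProbabilityMeasure (μ.map (f p)) := fun p =>
    Measure.isProbabilityMeasure_map (hf p).aemeasurable
  have hrow : ∀ i, μ.map (fun ω j => f (i, j) ω) = Measure.infinitePi fun j => μ.map (f (i, j)) :=
    fun i => (h.precomp (Prod.mk_right_injective i)).map_fun_eq_infinitePi_map fun j => hf _
  rw [iIndepFun_iff_map_fun_eq_infinitePi_map
    fun i => measurable_pi_lambda _ fun j => hf _]
  simp_rw [hrow]
  rw [← Measure.infinitePi_map_curry (fun i j => μ.map (f (i, j))),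
    ← h.map_fun_eq_infinitePi_map hf, Measure.map_map (by fun_prop) (by fun_prop)]
  rfl

/-- Disjoint subfamilies of an independent family are independent. -/
theorem indepFun_restrict_of_disjoint {ι E : Type*} [mE : MeasurableSpace E] {X : ι → Ω → E}
    (hX : ∀ i, Measurable (X i)) (h : iIndepFun X μ) {S T : Set ι} (hST : Disjoint S T) :
    IndepFun (fun ω (s : S) => X s ω) (fun ω (s : T) => X s ω) μ := by
  have hle : ∀ S : Set ι, MeasurableSpace.comap (fun ω (s : S) => X s ω) MeasurableSpace.pi ≤
      ⨆ i ∈ S, MeasurableSpace.comap (X i) mE := by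
    intro S
    simp only [MeasurableSpace.pi, MeasurableSpace.comap_iSup, MeasurableSpace.comap_comp]
    exact iSup_le fun s => le_iSup₂_of_le s.1 s.2 le_rfl
  rw [IndepFun_iff_Indep]
  exact indep_of_indep_of_le_left (indep_of_indep_of_le_right
    (indep_iSup_of_disjoint (fun i => (hX i).comap_le) h.iIndep hST) (hle T)) (hle S)

/-- The hypotheses make the law of the triple a product of three laws, which can be regrouped. -/
theorem indepFun_prodMk_of_indepFun_prodMk [IsProbabilityMeasure μ] {α β γ : Type*}
    [MeasurableSpace α] [MeasurableSpace β] [MeasurableSpace γ] {A : Ω → α} {B : Ω → β} {Z : Ω → γ}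
    (hA : Measurable A) (hB : Measurable B) (hZ : Measurable Z)
    (h1 : IndepFun A B μ) (h2 : IndepFun (fun ω => (A ω, B ω)) Z μ) :
    IndepFun B (fun ω => (A ω, Z ω)) μ := by
  have := Measure.isProbabilityMeasure_map (μ := μ) hA.aemeasurable
  have := Measure.isProbabilityMeasure_map (μ := μ) hB.aemeasurable
  have := Measure.isProbabilityMeasure_map (μ := μ) hZ.aemeasurable
  have hAZ : IndepFun A Z μ := h2.comp measurable_fst measurable_id
  rw [indepFun_iff_map_prod_eq_prod_map_map hB.aemeasurable (hA.prodMk hZ).aemeasurable,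
    hAZ.map_prod_eq_prod_map_map hA.aemeasurable hZ.aemeasurable]
  have h2' := h2.map_prod_eq_prod_map_map (hA.prodMk hB).aemeasurable hZ.aemeasurable
  rw [h1.map_prod_eq_prod_map_map hA.aemeasurable hB.aemeasurable] at h2'
  have hmp := (measurePreserving_prodAssoc (μ.map B) (μ.map A) (μ.map Z)).comp
    ((Measure.measurePreserving_swap (μ := μ.map A) (ν := μ.map B)).prod
      (MeasurePreserving.id (μ.map Z)))
  rw [← hmp.map_eq, ← h2', Measure.map_map hmp.measurable ((hA.prodMk hB).prodMk hZ)]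
  rfl

end Independence

/-! ### Laws and independence of channels and distance measures -/

theorem fin3_add_one_ne : ∀ i : Fin 3, i + 1 ≠ i := by decide

theorem fin3_add_two_ne : ∀ i : Fin 3, i + 2 ≠ i := by decide

theorem fin3_add_one_ne_add_two : ∀ i : Fin 3, i + 1 ≠ i + 2 := by decide

section Network

variable {Ω : Type*} {d : ℕ}

/-- The entries of the channel matrix from transmitter `s.2.1` to user `s.2.2` of cell `s.1`. -/
def chanMat (H : Fin 3 → Fin 3 → ℕ → Ω → Matrix (Fin (2 * d)) (Fin d) ℂ)
    (s : Fin 3 × Fin 3 × ℕ) (ω : Ω) : Fin (2 * d) → Fin d → ℂ :=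
  fun a b => H s.1 s.2.1 s.2.2 ω a b

variable [MeasurableSpace Ω] {μ : Measure Ω}
  {H : Fin 3 → Fin 3 → ℕ → Ω → Matrix (Fin (2 * d)) (Fin d) ℂ}

namespace IsIIDRayleigh

theorem measurable_chanMat (hH : IsIIDRayleigh μ H) (s : Fin 3 × Fin 3 × ℕ) :
    Measurable (chanMat H s) :=
  measurable_pi_lambda _ fun a => measurable_pi_lambda _ fun b =>
    hH.measurable (s.1, s.2.1, s.2.2, a, b)

theorem measurable_userDist (hH : IsIIDRayleigh μ H) (i : Fin 3) (k : ℕ) :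
    Measurable (userDist H i k) :=
  (hH.measurable_chanMat (i, i + 1, k)).spanDist (hH.measurable_chanMat (i, i + 2, k))

theorem iIndepFun_row (hH : IsIIDRayleigh μ H) :
    iIndepFun (fun (p : (Fin 3 × Fin 3 × ℕ) × Fin (2 * d)) ω => chanMat H p.1 ω p.2) μ := by
  let e : ((Fin 3 × Fin 3 × ℕ) × Fin (2 * d)) × Fin d → Fin 3 × Fin 3 × ℕ × Fin (2 * d) × Fin d :=
    fun p => (p.1.1.1, p.1.1.2.1, p.1.1.2.2, p.1.2, p.2)
  have he : Function.Injective e := by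
    rintro ⟨⟨⟨i, j, k⟩, a⟩, b⟩ ⟨⟨⟨i', j', k'⟩, a'⟩, b'⟩ h
    simp only [e, Prod.mk.injEq] at h ⊢
    tauto
  exact iIndepFun_curry (fun p => hH.measurable (e p)) (hH.indep.precomp he)

theorem iIndepFun_chanMat (hH : IsIIDRayleigh μ H) : iIndepFun (chanMat H) μ :=
  iIndepFun_curry (f := fun (p : (Fin 3 × Fin 3 × ℕ) × Fin (2 * d)) ω => chanMat H p.1 ω p.2)
    (fun p => (measurable_pi_apply p.2).comp (hH.measurable_chanMat p.1)) hH.iIndepFun_row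

theorem isProbabilityMeasure (hH : IsIIDRayleigh μ H) : IsProbabilityMeasure μ :=
  hH.indep.isProbabilityMeasure

theorem hasLaw_chanMat (hH : IsIIDRayleigh μ H) (s : Fin 3 × Fin 3 × ℕ) :
    HasLaw (chanMat H s) (iidGaussian (2 * d) d) μ := by
  have hrow : ∀ a, HasLaw (fun ω => chanMat H s ω a) (Measure.pi fun _ => stdComplexGaussian) μ := by
    intro a
    refine iIndepFun.hasLaw_pi (fun b => hH.law (s.1, s.2.1, s.2.2, a, b))
      (hH.indep.precomp (g := fun b => (s.1, s.2.1, s.2.2, a, b)) fun b b' h => ?_)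
    simpa using h
  exact iIndepFun.hasLaw_pi hrow (hH.iIndepFun_row.precomp (Prod.mk_right_injective s))

theorem map_chanMat (hH : IsIIDRayleigh μ H) (s : Fin 3 × Fin 3 × ℕ) :
    μ.map (chanMat H s) = iidGaussian (2 * d) d := (hH.hasLaw_chanMat s).map_eq

theorem map_chanMat_prod (hH : IsIIDRayleigh μ H) {s t : Fin 3 × Fin 3 × ℕ} (hst : s ≠ t) :
    μ.map (fun ω => (chanMat H s ω, chanMat H t ω)) =
      (iidGaussian (2 * d) d).prod (iidGaussian (2 * d) d) := by
  have := hH.isProbabilityMeasure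
  rw [(hH.iIndepFun_chanMat.indepFun hst).map_prod_eq_prod_map_map
    (hH.measurable_chanMat s).aemeasurable (hH.measurable_chanMat t).aemeasurable,
    hH.map_chanMat, hH.map_chanMat]

/-- A product law gives at once the law of the distance measure and its independence of the second
interference channel, although it is computed from that channel. -/
theorem map_userDist_prod (hH : IsIIDRayleigh μ H) (i : Fin 3) (k : ℕ) :
    μ.map (fun ω => (userDist H i k ω, chanMat H (i, i + 2, k) ω)) =
      ((iidGaussian (2 * d) d).map stdSpanDist).prod (iidGaussian (2 * d) d) := by
  have hne : (i, i + 1, k) ≠ (i, i + 2, k) := by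
    intro h
    exact fin3_add_one_ne_add_two i (congrArg (fun s => s.2.1) h)
  rw [← map_spanDist_prod_iidGaussian (by omega), ← hH.map_chanMat_prod hne,
    Measure.map_map (measurable_spanDist.prodMk measurable_snd)
      ((hH.measurable_chanMat _).prodMk (hH.measurable_chanMat _))]
  rfl

theorem map_userDist (hH : IsIIDRayleigh μ H) (i : Fin 3) (k : ℕ) :
    μ.map (userDist H i k) = (iidGaussian (2 * d) d).map stdSpanDist := by
  have := hH.isProbabilityMeasure
  have := congrArg (Measure.map Prod.fst) (hH.map_userDist_prod i k)
  rw [Measure.map_fst_prod, measure_univ, one_smul, Measure.map_map measurable_fst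
    ((hH.measurable_userDist i k).prodMk (hH.measurable_chanMat _))] at this
  exact this

theorem indepFun_userDist_chanMat (hH : IsIIDRayleigh μ H) (i : Fin 3) (k : ℕ) :
    IndepFun (userDist H i k) (chanMat H (i, i + 2, k)) μ := by
  have := hH.isProbabilityMeasure
  rw [indepFun_iff_map_prod_eq_prod_map_map (hH.measurable_userDist i k).aemeasurable
    (hH.measurable_chanMat _).aemeasurable, hH.map_userDist_prod, hH.map_userDist, hH.map_chanMat]

/-- The interference channel from transmitter `i + 2` is independent of the distance measures of
all users. -/
theorem indepFun_chanMat_userDist (hH : IsIIDRayleigh μ H) (i : Fin 3) (k : ℕ) :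
    IndepFun (chanMat H (i, i + 2, k)) (fun ω l => userDist H i l ω) μ := by
  have := hH.isProbabilityMeasure
  -- The channels of users with index `k` are separated from those with other indices. Within the
  -- first group the distance is independent of the channel by unitary invariance; the second group
  -- supplies the remaining distances.
  let S : Set (Fin 3 × Fin 3 × ℕ) := {s | s.2.2 = k}
  let T : Set (Fin 3 × Fin 3 × ℕ) := {s | s.2.2 ≠ k}
  have hST : Disjoint S T := Set.disjoint_left.2 fun s hs ht => ht hs
  have hind := indepFun_restrict_of_disjoint hH.measurable_chanMat hH.iIndepFun_chanMat hST
  let φ : (S → Fin (2 * d) → Fin d → ℂ) → ℝ × (Fin (2 * d) → Fin d → ℂ) := fun x =>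
    (spanDist (x ⟨(i, i + 1, k), rfl⟩) (x ⟨(i, i + 2, k), rfl⟩), x ⟨(i, i + 2, k), rfl⟩)
  have hφ : Measurable φ := ((measurable_pi_apply _).spanDist (measurable_pi_apply _)).prodMk (measurable_pi_apply _)
  obtain ⟨ψ, hψ, hψl⟩ : ∃ ψ : (T → Fin (2 * d) → Fin d → ℂ) → ℕ → ℝ, Measurable ψ ∧
      ∀ x l (h : l ≠ k), ψ x l = spanDist (x ⟨(i, i + 1, l), h⟩) (x ⟨(i, i + 2, l), h⟩) := by
    refine ⟨fun x l => if h : l ≠ k then spanDist (x ⟨(i, i + 1, l), h⟩) (x ⟨(i, i + 2, l), h⟩)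
      else 0, measurable_pi_lambda _ fun l => ?_, fun x l h => dif_pos h⟩
    by_cases h : l ≠ k
    · simp only [h, not_false_eq_true, ne_eq, dif_pos]
      exact (measurable_pi_apply _).spanDist (measurable_pi_apply _)
    · simp only [h, dif_neg, not_false_eq_true]
      exact measurable_const
  have hother : Measurable fun ω => ψ fun s : T => chanMat H s ω :=
    hψ.comp (measurable_pi_lambda _ fun s => hH.measurable_chanMat s)
  have hpair : IndepFun (fun ω => (userDist H i k ω, chanMat H (i, i + 2, k) ω))
      (fun ω => ψ fun s : T => chanMat H s ω) μ := by
    have h := hind.comp hφ hψ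
    have hφe : (fun ω => (userDist H i k ω, chanMat H (i, i + 2, k) ω)) =
        φ ∘ fun ω (s : S) => chanMat H s ω := rfl
    rw [hφe]
    exact h
  have h3 := indepFun_prodMk_of_indepFun_prodMk (hH.measurable_userDist i k)
    (hH.measurable_chanMat (i, i + 2, k)) hother (hH.indepFun_userDist_chanMat i k) hpair
  have hupd : Measurable fun z : ℝ × (ℕ → ℝ) => fun l => if l = k then z.1 else z.2 l := by
    refine measurable_pi_lambda _ fun l => ?_
    by_cases h : l = k
    · simp only [h, if_true]; exact measurable_fst
    · simp only [h, if_false]; exact (measurable_pi_apply l).comp measurable_snd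
  have h4 : IndepFun (chanMat H (i, i + 2, k)) (fun ω l => if l = k then userDist H i k ω else
      ψ (fun s : T => chanMat H s ω) l) μ := h3.comp measurable_id hupd
  have h5 : (fun ω l => userDist H i l ω) = fun ω l => if l = k then userDist H i k ω else
      ψ (fun s : T => chanMat H s ω) l := by
    ext ω l
    by_cases h : l = k
    · rw [if_pos h, h]
    · simp only [if_neg h, hψl _ _ h]
      rfl
  rw [h5]
  exact h4

/-- The direct channel of a user is independent of all distance measures and of the interference
channels of this user. -/
theorem indepFun_direct (hH : IsIIDRayleigh μ H) (i : Fin 3) (k : ℕ) :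
    IndepFun (chanMat H (i, i, k)) (fun ω => ((fun l => userDist H i l ω),
      chanMat H (i, i + 1, k) ω, chanMat H (i, i + 2, k) ω)) μ := by
  have h1 : ∀ l, (i, i + 1, l) ≠ (i, i, k) := by
    intro l h
    exact fin3_add_one_ne i (congrArg (fun s => s.2.1) h)
  have h2 : ∀ l, (i, i + 2, l) ≠ (i, i, k) := by
    intro l h
    exact fin3_add_two_ne i (congrArg (fun s => s.2.1) h)
  let S : Set (Fin 3 × Fin 3 × ℕ) := {s | s = (i, i, k)}
  let T : Set (Fin 3 × Fin 3 × ℕ) := {s | s ≠ (i, i, k)}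
  have hST : Disjoint S T := Set.disjoint_left.2 fun s hs ht => ht hs
  have hind := indepFun_restrict_of_disjoint hH.measurable_chanMat hH.iIndepFun_chanMat hST
  let φ : (S → Fin (2 * d) → Fin d → ℂ) → (Fin (2 * d) → Fin d → ℂ) := fun x => x ⟨(i, i, k), rfl⟩
  have hφ : Measurable φ := measurable_pi_apply _
  let ψ : (T → Fin (2 * d) → Fin d → ℂ) →
      (ℕ → ℝ) × (Fin (2 * d) → Fin d → ℂ) × (Fin (2 * d) → Fin d → ℂ) := fun x =>
    ((fun l => spanDist (x ⟨(i, i + 1, l), h1 l⟩) (x ⟨(i, i + 2, l), h2 l⟩)),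
      x ⟨(i, i + 1, k), h1 k⟩, x ⟨(i, i + 2, k), h2 k⟩)
  have hψ : Measurable ψ :=
    (measurable_pi_lambda _ fun l => (measurable_pi_apply _).spanDist (measurable_pi_apply _)).prodMk
      ((measurable_pi_apply _).prodMk (measurable_pi_apply _))
  exact hind.comp hφ hψ

theorem iIndepFun_userDist (hH : IsIIDRayleigh μ H) (i : Fin 3) :
    iIndepFun (fun k => userDist H i k) μ := by
  have hinj : Function.Injective fun p : ℕ × Fin 3 => (i, p.2, p.1) := by
    rintro ⟨k, j⟩ ⟨k', j'⟩ h
    simp only [Prod.mk.injEq] at h ⊢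
    tauto
  have h := iIndepFun_curry (fun p => hH.measurable_chanMat (i, p.2, p.1))
    (hH.iIndepFun_chanMat.precomp hinj)
  exact h.comp (fun _ x => spanDist (x (i + 1)) (x (i + 2))) fun _ =>
    (measurable_pi_apply _).spanDist (measurable_pi_apply _)

theorem ae_linearIndependent (hH : IsIIDRayleigh μ H) (s : Fin 3 × Fin 3 × ℕ) :
    ∀ᵐ ω ∂μ, LinearIndependent ℂ (fun c : Fin d => fun a : Fin (2 * d) => chanMat H s ω a c) := by
  have h := ae_linearIndependent_iidGaussian (m := 2 * d) (n := d) (by omega)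
  rw [← hH.map_chanMat s] at h
  exact ae_of_ae_map (hH.measurable_chanMat s).aemeasurable h

theorem integrable_frobSq_chanMat (hH : IsIIDRayleigh μ H) (s : Fin 3 × Fin 3 × ℕ) :
    Integrable (fun ω => frobSq (Matrix.of (chanMat H s ω))) μ := by
  have h := integrable_frobSq_iidGaussian (m := 2 * d) (n := d)
  rw [← hH.map_chanMat s] at h
  exact h.comp_measurable (hH.measurable_chanMat s)

theorem integral_frobSq_chanMat (hH : IsIIDRayleigh μ H) (s : Fin 3 × Fin 3 × ℕ) :
    ∫ ω, frobSq (Matrix.of (chanMat H s ω)) ∂μ =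
      ∫ h, frobSq (Matrix.of h) ∂(iidGaussian (2 * d) d) := by
  rw [← hH.map_chanMat s, integral_map (hH.measurable_chanMat s).aemeasurable]
  rw [hH.map_chanMat s]
  exact integrable_frobSq_iidGaussian.aestronglyMeasurable

/-- With probability close to one, one of many users has a small distance measure. -/
theorem exists_measure_outage_le (hH : IsIIDRayleigh μ H) (hd : 1 ≤ d) (i : Fin 3) :
    ∃ c > 0, ∀ x : ℝ, 0 < x → x ≤ 1 → ∀ K : ℕ,
      μ.real {ω | ∀ k < K, x ≤ userDist H i k ω} ≤ Real.exp (-(c * x ^ (d ^ 2) * K)) := by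
  have := hH.isProbabilityMeasure
  obtain ⟨c, hc, h⟩ := exists_le_iidGaussian_stdSpanDist_lt hd
  refine ⟨c, hc, fun x hx hx1 K => ?_⟩
  have hset : {ω | ∀ k < K, x ≤ userDist H i k ω} =
      ⋂ k ∈ Finset.range K, userDist H i k ⁻¹' Set.Ici x := by
    ext ω; simp
  have hone : ∀ k, μ (userDist H i k ⁻¹' Set.Ici x) ≤ ENNReal.ofReal (1 - c * x ^ (d ^ 2)) := by
    intro k
    have hc' : userDist H i k ⁻¹' Set.Ici x = (userDist H i k ⁻¹' Set.Iio x)ᶜ := by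
      ext ω; simp
    rw [hc', prob_compl_eq_one_sub (hH.measurable_userDist i k measurableSet_Iio),
      ← Measure.map_apply (hH.measurable_userDist i k) measurableSet_Iio, hH.map_userDist,
      Measure.map_apply measurable_stdSpanDist measurableSet_Iio, ENNReal.ofReal_sub _ (by positivity),
      ENNReal.ofReal_one]
    exact tsub_le_tsub_left (h x hx hx1) _
  -- With `1 - y ≤ exp (-y)` the product over the `K` independent users becomes a single
  -- exponential.
  have hexp : ENNReal.ofReal (1 - c * x ^ (d ^ 2)) ≤ ENNReal.ofReal (Real.exp (-(c * x ^ (d ^ 2)))) :=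
    ENNReal.ofReal_le_ofReal (by linarith [Real.add_one_le_exp (-(c * x ^ (d ^ 2)))])
  have hle : μ {ω | ∀ k < K, x ≤ userDist H i k ω} ≤
      ENNReal.ofReal (Real.exp (-(c * x ^ (d ^ 2) * K))) := by
    rw [hset, (hH.iIndepFun_userDist i).meas_biInter
      fun k _ => ⟨Set.Ici x, measurableSet_Ici, rfl⟩]
    calc ∏ k ∈ Finset.range K, μ (userDist H i k ⁻¹' Set.Ici x)
        ≤ ∏ _k ∈ Finset.range K, ENNReal.ofReal (Real.exp (-(c * x ^ (d ^ 2)))) :=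
          Finset.prod_le_prod' fun k _ => (hone k).trans hexp
      _ = _ := by
          rw [Finset.prod_const, Finset.card_range, ← ENNReal.ofReal_pow (Real.exp_pos _).le,
            ← Real.exp_nat_mul]
          congr 2; ring
  exact ENNReal.toReal_le_of_le_ofReal (Real.exp_pos _).le hle

end IsIIDRayleigh

end Network


/-! ### The two feedback schemes as selection rules -/

section Selection

/-- A rule by which the distance measures `v` of the users `0, …, K - 1` determine the probability
`w k v` with which each user `k` is served. -/
structure IsSelectionRule (K : ℕ) (w : ℕ → (ℕ → ℝ) → ℝ) : Prop where
  measurable : ∀ k, Measurable (w k)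
  nonneg : ∀ k v, 0 ≤ w k v
  sum_eq_one : ∀ v, ∑ k ∈ Finset.range K, w k v = 1

namespace IsSelectionRule

variable {K : ℕ} {w : ℕ → (ℕ → ℝ) → ℝ}

theorem le_one (hw : IsSelectionRule K w) {k : ℕ} (hk : k < K) (v : ℕ → ℝ) : w k v ≤ 1 := by
  rw [← hw.sum_eq_one v]
  exact Finset.single_le_sum (f := fun k => w k v) (fun k _ => hw.nonneg k v)
    (Finset.mem_range.2 hk)

theorem sum_mul_le (hw : IsSelectionRule K w) {v : ℕ → ℝ} {y : ℝ}
    (h : ∀ k < K, w k v ≠ 0 → v k ≤ y) : ∑ k ∈ Finset.range K, w k v * v k ≤ y := by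
  calc ∑ k ∈ Finset.range K, w k v * v k ≤ ∑ k ∈ Finset.range K, w k v * y := by
        refine Finset.sum_le_sum fun k hk => ?_
        by_cases h0 : w k v = 0
        · simp [h0]
        · exact mul_le_mul_of_nonneg_left (h k (Finset.mem_range.1 hk) h0) (hw.nonneg k v)
    _ = y := by rw [← Finset.sum_mul, hw.sum_eq_one, one_mul]

end IsSelectionRule

theorem bestUser_spec (v : ℕ → ℝ) {K : ℕ} (hK : 1 ≤ K) :
    bestUser v K < K ∧ ∀ l < K, v (bestUser v K) ≤ v l := by
  have hne : {k | k < K ∧ ∀ l < K, v k ≤ v l}.Nonempty := by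
    obtain ⟨k, hk, h⟩ := Finset.exists_min_image (Finset.range K) v ⟨0, Finset.mem_range.2 hK⟩
    exact ⟨k, Finset.mem_range.1 hk, fun l hl => h l (Finset.mem_range.2 hl)⟩
  exact Nat.sInf_mem hne

theorem measurable_bestUser {K : ℕ} (hK : 1 ≤ K) : Measurable fun v : ℕ → ℝ => bestUser v K := by
  have hmin : ∀ k, MeasurableSet {v : ℕ → ℝ | ∀ l < K, v k ≤ v l} := by
    intro k
    have : {v : ℕ → ℝ | ∀ l < K, v k ≤ v l} = ⋂ l ∈ Finset.range K, {v : ℕ → ℝ | v k ≤ v l} := by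
      ext v; simp
    rw [this]
    exact Finset.measurableSet_biInter _ fun l _ =>
      measurableSet_le (measurable_pi_apply k) (measurable_pi_apply l)
  refine measurable_to_countable' fun k => ?_
  by_cases hk : k < K
  -- Ties go to the smallest index: `k` is chosen exactly when it minimizes and no smaller index
  -- does.
  · have : (fun v : ℕ → ℝ => bestUser v K) ⁻¹' {k} = {v : ℕ → ℝ | ∀ l < K, v k ≤ v l} ∩
        ⋂ j ∈ Finset.range k, {v : ℕ → ℝ | ∀ l < K, v j ≤ v l}ᶜ := by
      ext v
      simp only [Set.mem_preimage, Set.mem_singleton_iff, Set.mem_inter_iff, Set.mem_iInter,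
        Finset.mem_range, Set.mem_compl_iff]
      constructor
      · rintro rfl
        refine ⟨(bestUser_spec v hK).2, fun j hj h => ?_⟩
        exact Nat.notMem_of_lt_sInf hj ⟨hj.trans hk, h⟩
      · rintro ⟨h1, h2⟩
        refine le_antisymm (Nat.sInf_le ⟨hk, h1⟩) (not_lt.1 fun h => h2 _ h (bestUser_spec v hK).2)
    rw [this]
    exact (hmin k).inter (Finset.measurableSet_biInter _ fun j _ => (hmin j).compl)
  · have : (fun v : ℕ → ℝ => bestUser v K) ⁻¹' {k} = ∅ := by
      ext v
      simp only [Set.mem_preimage, Set.mem_singleton_iff, Set.mem_empty_iff_false, iff_false]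
      rintro rfl
      exact hk (bestUser_spec v hK).1
    rw [this]
    exact MeasurableSet.empty

/-- The selection rule that serves the user with the smallest distance measure. -/
def bestWeight (K k : ℕ) (v : ℕ → ℝ) : ℝ := if bestUser v K = k then 1 else 0

theorem isSelectionRule_bestWeight {K : ℕ} (hK : 1 ≤ K) : IsSelectionRule K (bestWeight K) where
  measurable k := Measurable.ite (measurable_bestUser hK (measurableSet_singleton k))
    measurable_const measurable_const
  nonneg k v := by unfold bestWeight; split_ifs <;> norm_num
  sum_eq_one v := by
    simp only [bestWeight, Finset.sum_ite_eq, Finset.mem_range, (bestUser_spec v hK).1, if_true]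

/-- This brings perfect feedback under the threshold argument: if some user is below `x`, the
minimizer is too. -/
theorem bestWeight_ne_zero {K : ℕ} (hK : 1 ≤ K) {v : ℕ → ℝ} {x : ℝ} (hx : ∃ l < K, v l < x) (k : ℕ)
    (h : bestWeight K k v ≠ 0) : v k ≤ x := by
  have hk : bestUser v K = k := by
    by_contra h'; exact h (if_neg h')
  obtain ⟨l, hl, hlx⟩ := hx
  rw [← hk]
  exact ((bestUser_spec v hK).2 l hl).trans hlx.le

open Classical in
/-- The selection rule that serves a uniformly chosen candidate under 1-bit feedback. -/
def oneBitWeight (x : ℝ) (K k : ℕ) (v : ℕ → ℝ) : ℝ :=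
  if k ∈ oneBitCandidates v x K then 1 / ((oneBitCandidates v x K).card : ℝ) else 0

theorem oneBitCandidates_subset (v : ℕ → ℝ) (x : ℝ) (K : ℕ) :
    oneBitCandidates v x K ⊆ Finset.range K := by
  unfold oneBitCandidates
  split_ifs
  · exact Finset.filter_subset _ _
  · exact subset_rfl

theorem oneBitCandidates_nonempty (v : ℕ → ℝ) (x : ℝ) {K : ℕ} (hK : 1 ≤ K) :
    (oneBitCandidates v x K).Nonempty := by
  unfold oneBitCandidates
  split_ifs with h
  · exact h
  · exact ⟨0, Finset.mem_range.2 hK⟩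

theorem oneBitCandidates_congr {v v' : ℕ → ℝ} {x x' : ℝ} {K : ℕ}
    (h : ∀ k < K, (v k < x ↔ v' k < x')) : oneBitCandidates v x K = oneBitCandidates v' x' K := by
  classical
  have : ((Finset.range K).filter fun k => v k < x) = (Finset.range K).filter fun k => v' k < x' :=
    Finset.filter_congr fun k hk => h k (Finset.mem_range.1 hk)
  unfold oneBitCandidates
  convert rfl using 2
  all_goals simp only [this]

theorem measurable_oneBitWeight (x : ℝ) (K k : ℕ) : Measurable (oneBitWeight x K k) := by
  classical
  -- the weight depends on the feedback bits only
  let bits : (ℕ → ℝ) → Fin K → Bool := fun v l => decide (v l < x)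
  -- The values `0` and `1`, compared with threshold `1`, reproduce the bits; values at indices from
  -- `K` on play no role. The weight thus factors through a finite set.
  let unbits : (Fin K → Bool) → ℕ → ℝ := fun b l => if h : l < K then if b ⟨l, h⟩ then 0 else 1 else 0
  have hbits : Measurable bits := by
    refine measurable_pi_lambda _ fun l => ?_
    refine measurable_to_bool ?_
    have : (fun v : ℕ → ℝ => bits v l) ⁻¹' {true} = {v : ℕ → ℝ | v l < x} := by
      ext v; simp [bits]
    rw [this]
    exact measurableSet_lt (measurable_pi_apply _) measurable_const
  have hfac : oneBitWeight x K k = (fun b => oneBitWeight 1 K k (unbits b)) ∘ bits := by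
    ext v
    have : oneBitCandidates v x K = oneBitCandidates (unbits (bits v)) 1 K := by
      refine oneBitCandidates_congr fun l hl => ?_
      by_cases h : v l < x <;> simp [unbits, bits, hl, h]
    simp only [oneBitWeight, this, Function.comp_apply]
  rw [hfac]
  exact (measurable_of_finite _).comp hbits

theorem isSelectionRule_oneBitWeight (x : ℝ) {K : ℕ} (hK : 1 ≤ K) :
    IsSelectionRule K (oneBitWeight x K) where
  measurable := measurable_oneBitWeight x K
  nonneg k v := by unfold oneBitWeight; split_ifs <;> positivity
  sum_eq_one v := by
    classical
    have hc : ((oneBitCandidates v x K).card : ℝ) ≠ 0 := by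
      exact_mod_cast (oneBitCandidates_nonempty v x hK).card_pos.ne'
    have h1 : ∑ k ∈ Finset.range K, oneBitWeight x K k v =
        ∑ k ∈ oneBitCandidates v x K, 1 / ((oneBitCandidates v x K).card : ℝ) := by
      rw [← Finset.sum_subset (oneBitCandidates_subset v x K)
        fun k _ hk => by simp [oneBitWeight, hk]]
      exact Finset.sum_congr rfl fun k hk => by simp [oneBitWeight, hk]
    rw [h1, Finset.sum_const, nsmul_eq_mul, mul_one_div_cancel hc]

theorem oneBitWeight_ne_zero {K : ℕ} {v : ℕ → ℝ} {x : ℝ} (hx : ∃ l < K, v l < x) (k : ℕ)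
    (h : oneBitWeight x K k v ≠ 0) : v k ≤ x := by
  classical
  have hk : k ∈ oneBitCandidates v x K := by
    by_contra h'; exact h (if_neg h')
  obtain ⟨l, hl, hlx⟩ := hx
  unfold oneBitCandidates at hk
  rw [if_pos ⟨l, Finset.mem_filter.2 ⟨Finset.mem_range.2 hl, hlx⟩⟩] at hk
  exact (Finset.mem_filter.1 hk).2.le

end Selection

/-! ### Expected rate of a selected user -/

section Network

variable {Ω : Type*} {d : ℕ} {H : Fin 3 → Fin 3 → ℕ → Ω → Matrix (Fin (2 * d)) (Fin d) ℂ}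
  {u : Matrix (Fin (2 * d)) (Fin (2 * d)) ℂ → Matrix (Fin (2 * d)) (Fin d) ℂ}

/-- The rate that user `k` of cell `i` would have without residual interference. -/
def interferenceFreeRate
    (u : Matrix (Fin (2 * d)) (Fin (2 * d)) ℂ → Matrix (Fin (2 * d)) (Fin d) ℂ)
    (H : Fin 3 → Fin 3 → ℕ → Ω → Matrix (Fin (2 * d)) (Fin d) ℂ)
    (P : ℝ) (i : Fin 3) (k : ℕ) (ω : Ω) : ℝ :=
  pointToPointRate d P ((u (interferenceCov (H i (i + 1) k ω) (H i (i + 2) k ω)))ᴴ * H i i k ω)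

theorem userRate_nonneg (hu : IsPostfilter d u) {P : ℝ} (hP : 0 ≤ P) (i : Fin 3) (k : ℕ) (ω : Ω) :
    0 ≤ userRate u H P i k ω :=
  (instRate_postfilter_bounds hP u hu _ _ _).1

theorem userRate_le_interferenceFreeRate (hu : IsPostfilter d u) {P : ℝ} (hP : 0 ≤ P) (i : Fin 3)
    (k : ℕ) (ω : Ω) : userRate u H P i k ω ≤ interferenceFreeRate u H P i k ω :=
  (instRate_postfilter_bounds hP u hu _ _ _).2.1

theorem userDist_nonneg (i : Fin 3) (k : ℕ) (ω : Ω) : 0 ≤ userDist H i k ω := sq_nonneg _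

theorem userDist_le (i : Fin 3) (k : ℕ) (ω : Ω) :
    userDist H i k ω ≤ 2 * (((2 * d : ℕ) : ℝ) * d) ^ 2 :=
  chordalDist_orthBasis_sq_le _ _

variable [MeasurableSpace Ω] {μ : Measure Ω}

/-- `κ` serves user `k` with conditional probability `w k` given the channels. -/
structure IsSelectedBy (μ : Measure Ω)
    (H : Fin 3 → Fin 3 → ℕ → Ω → Matrix (Fin (2 * d)) (Fin d) ℂ) (i : Fin 3) (K : ℕ)
    (w : ℕ → (ℕ → ℝ) → ℝ) (κ : Ω → ℕ) : Prop where
  measurable : Measurable κ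
  lt : ∀ᵐ ω ∂μ, κ ω < K
  integral_eq : ∀ k < K, ∀ ψ : (Fin 3 × Fin 3 × ℕ × Fin (2 * d) × Fin d → ℂ) → ℝ, Measurable ψ →
    Integrable (fun ω => ψ fun t => channelEntry H t ω) μ →
    ∫ ω, (κ ⁻¹' {k}).indicator (fun ω => ψ fun t => channelEntry H t ω) ω ∂μ =
      ∫ ω, w k (fun l => userDist H i l ω) * ψ (fun t => channelEntry H t ω) ∂μ

theorem IsIIDRayleigh.measurable_userDist_pi (hH : IsIIDRayleigh μ H) (i : Fin 3) :
    Measurable fun ω l => userDist H i l ω :=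
  measurable_pi_lambda _ fun l => hH.measurable_userDist i l

theorem isSelectedBy_bestUser (hH : IsIIDRayleigh μ H) (i : Fin 3) {K : ℕ} (hK : 1 ≤ K) :
    IsSelectedBy μ H i K (bestWeight K) (fun ω => bestUser (fun k => userDist H i k ω) K) where
  measurable := (measurable_bestUser hK).comp (hH.measurable_userDist_pi i)
  lt := ae_of_all _ fun ω => (bestUser_spec _ hK).1
  integral_eq k _ ψ _ _ := by
    congr 1
    ext ω
    by_cases h : bestUser (fun k => userDist H i k ω) K = k
    · simp [bestWeight, h]
    · simp [bestWeight, h]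

theorem channelSigma_le (hH : IsIIDRayleigh μ H) :
    channelSigma H ≤ (inferInstance : MeasurableSpace Ω) :=
  (measurable_pi_lambda _ hH.measurable).comap_le

theorem isSelectedBy_oneBit (hH : IsIIDRayleigh μ H) (i : Fin 3) {K : ℕ}
    {x : ℝ} {κ : Ω → ℕ} (hκ : IsUniformPick (channelSigma H) μ
      (fun ω => oneBitCandidates (fun k => userDist H i k ω) x K) κ) :
    IsSelectedBy μ H i K (oneBitWeight x K) κ := by
  classical
  have := hH.isProbabilityMeasure
  have hm := channelSigma_le hH
  have hset : ∀ k, MeasurableSet {ω | κ ω = k} := fun k => hκ.measurable (measurableSet_singleton k)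
  have hint : ∀ k, Integrable (({ω | κ ω = k}).indicator fun _ => (1 : ℝ)) μ := fun k =>
    (integrable_const 1).indicator (hset k)
  refine ⟨hκ.measurable, ?_, ?_⟩
  -- An index outside the candidate range has conditional probability zero, hence probability zero.
  · have h0 : ∀ k, K ≤ k → ∀ᵐ ω ∂μ, κ ω ≠ k := by
      intro k hk
      have h1 : μ[({ω | κ ω = k}).indicator (fun _ => (1 : ℝ)) | channelSigma H] =ᵐ[μ] 0 := by
        refine (hκ.uniform k).trans (ae_of_all _ fun ω => if_neg fun h => ?_)
        have := Finset.mem_range.1 (oneBitCandidates_subset _ _ _ h)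
        omega
      have h2 := integral_condExp hm (μ := μ) (f := ({ω | κ ω = k}).indicator fun _ => (1 : ℝ))
      rw [integral_congr_ae h1, integral_indicator_const (1 : ℝ) (hset k)] at h2
      simp only [Pi.zero_apply, integral_zero, smul_eq_mul, mul_one] at h2
      have h3 : μ {ω | κ ω = k} = 0 := (measureReal_eq_zero_iff).1 h2.symm
      rw [ae_iff]
      simpa using h3
    have h1 : ∀ᵐ ω ∂μ, ∀ k, K ≤ k → κ ω ≠ k := by
      rw [ae_all_iff]
      intro k
      by_cases hk : K ≤ k
      · filter_upwards [h0 k hk] with ω h _ using h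
      · exact ae_of_all _ fun ω h => absurd h hk
    filter_upwards [h1] with ω h
    exact not_le.1 fun hle => h _ hle rfl
  · intro k _ ψ hψ hψi
    have hψm : StronglyMeasurable[channelSigma H] fun ω => ψ fun t => channelEntry H t ω :=
      (hψ.comp (comap_measurable _)).stronglyMeasurable
    have hprod : (κ ⁻¹' {k}).indicator (fun ω => ψ fun t => channelEntry H t ω) =
        (({ω | κ ω = k}).indicator fun _ => (1 : ℝ)) * fun ω => ψ fun t => channelEntry H t ω := by
      ext ω
      by_cases h : κ ω = k <;> simp [h]
    have hpi : Integrable ((({ω | κ ω = k}).indicator fun _ => (1 : ℝ)) *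
        fun ω => ψ fun t => channelEntry H t ω) μ := by
      rw [← hprod]
      exact hψi.indicator (hset k)
    -- The function of the channels is pulled out of the conditional expectation, leaving the
    -- conditional probability of `κ = k`, which is the weight.
    have h1 := condExp_mul_of_stronglyMeasurable_right hψm hpi (hint k)
    rw [hprod, ← integral_condExp hm, integral_congr_ae h1]
    refine integral_congr_ae ?_
    filter_upwards [hκ.uniform k] with ω hω
    rw [Pi.mul_apply, hω]
    rfl

theorem IsIIDRayleigh.entrywiseMeasurable (hH : IsIIDRayleigh μ H) (i j : Fin 3) (k : ℕ) :
    EntrywiseMeasurable (H i j k) := fun a b => hH.measurable (i, j, k, a, b)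

theorem measurable_interferenceFreeRate (hH : IsIIDRayleigh μ H) (hu : IsPostfilter d u) (P : ℝ)
    (i : Fin 3) (k : ℕ) : Measurable (interferenceFreeRate u H P i k) :=
  ((hu.entrywiseMeasurable ((hH.entrywiseMeasurable i (i + 1) k).interferenceCov
    (hH.entrywiseMeasurable i (i + 2) k))).conjTranspose.mul
      (hH.entrywiseMeasurable i i k)).pointToPointRate P

theorem measurable_userRate (hH : IsIIDRayleigh μ H) (hu : IsPostfilter d u) (P : ℝ)
    (i : Fin 3) (k : ℕ) : Measurable (userRate u H P i k) :=
  EntrywiseMeasurable.instRate P (hH.entrywiseMeasurable i i k) (hH.entrywiseMeasurable i (i + 1) k)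
    (hH.entrywiseMeasurable i (i + 2) k) (hu.entrywiseMeasurable
      ((hH.entrywiseMeasurable i (i + 1) k).interferenceCov (hH.entrywiseMeasurable i (i + 2) k)))

theorem interferenceFreeRate_le (hH : IsIIDRayleigh μ H) (hu : IsPostfilter d u) {P : ℝ}
    (hP : 0 ≤ P) (i : Fin 3) (k : ℕ) :
    ∀ᵐ ω ∂μ, interferenceFreeRate u H P i k ω ≤ userRate u H P i k ω +
      2 / Real.log 2 * P * frobSq (Matrix.of (chanMat H (i, i + 2, k) ω)) * userDist H i k ω := by
  filter_upwards [hH.ae_linearIndependent (i, i + 2, k)] with ω hω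
  exact (instRate_postfilter_bounds hP u hu (H i i k ω) (H i (i + 1) k ω)
    (H i (i + 2) k ω)).2.2 hω

theorem integrable_interferenceFreeRate (hH : IsIIDRayleigh μ H) (hu : IsPostfilter d u) {P : ℝ}
    (hP : 0 ≤ P) (i : Fin 3) (k : ℕ) : Integrable (interferenceFreeRate u H P i k) μ := by
  have hlog : 0 < Real.log 2 := Real.log_pos one_lt_two
  refine Integrable.mono' (g := fun ω => P / d * (d * frobSq (Matrix.of (chanMat H (i, i, k) ω))) /
    Real.log 2) ((((hH.integrable_frobSq_chanMat (i, i, k)).const_mul _).const_mul _).div_const _)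
    (measurable_interferenceFreeRate hH hu P i k).aestronglyMeasurable (ae_of_all _ fun ω => ?_)
  unfold interferenceFreeRate
  rw [Real.norm_of_nonneg (pointToPointRate_nonneg hP _)]
  refine (pointToPointRate_le hP _).trans ?_
  gcongr
  refine (frobSq_mul_le _ _).trans_eq ?_
  have hU := hu.orthonormal _ (interferenceCov_posSemidef (H i (i + 1) k ω) (H i (i + 2) k ω))
  have hfr : frobSq (u (interferenceCov (H i (i + 1) k ω) (H i (i + 2) k ω)))ᴴ = d := by
    rw [frobSq_conjTranspose]
    have : ((frobSq (u (interferenceCov (H i (i + 1) k ω) (H i (i + 2) k ω))) : ℝ) : ℂ) = d := by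
      rw [ofReal_frobSq, hU, Matrix.trace_one, Fintype.card_fin]
    exact_mod_cast this
  rw [hfr]
  rfl

theorem integrable_userRate (hH : IsIIDRayleigh μ H) (hu : IsPostfilter d u) {P : ℝ}
    (hP : 0 ≤ P) (i : Fin 3) (k : ℕ) : Integrable (userRate u H P i k) μ :=
  (integrable_interferenceFreeRate hH hu hP i k).mono'
    (measurable_userRate hH hu P i k).aestronglyMeasurable (ae_of_all _ fun ω => by
      rw [Real.norm_of_nonneg (userRate_nonneg hu hP i k ω)]
      exact userRate_le_interferenceFreeRate hu hP i k ω)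

theorem integrable_mul_of_bounded {f g : Ω → ℝ} (hf : Measurable f) {C : ℝ} (h : ∀ ω, ‖f ω‖ ≤ C)
    (hg : Integrable g μ) : Integrable (fun ω => f ω * g ω) μ :=
  hg.bdd_mul hf.aestronglyMeasurable (ae_of_all _ h)

/-- The interference-free rate is independent of the selection. -/
theorem integral_weight_mul_interferenceFreeRate (hH : IsIIDRayleigh μ H) (hu : IsPostfilter d u)
    {P : ℝ} (hP : 0 ≤ P) (i : Fin 3) (k : ℕ) {w : (ℕ → ℝ) → ℝ} (hw : Measurable w)
    (hw1 : ∀ v, ‖w v‖ ≤ 1) :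
    ∫ ω, w (fun l => userDist H i l ω) * interferenceFreeRate u H P i k ω ∂μ =
      (∫ ω, w (fun l => userDist H i l ω) ∂μ) * ergodicCapacity d P := by
  have := hH.isProbabilityMeasure
  obtain ⟨Z, hZ⟩ : ∃ Z : Ω → (ℕ → ℝ) × (Fin (2 * d) → Fin d → ℂ) × (Fin (2 * d) → Fin d → ℂ),
      Z = fun ω => ((fun l => userDist H i l ω),
        chanMat H (i, i + 1, k) ω, chanMat H (i, i + 2, k) ω) := ⟨_, rfl⟩
  have hZm : Measurable Z := by
    rw [hZ]
    exact (hH.measurable_userDist_pi i).prodMk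
      ((hH.measurable_chanMat _).prodMk (hH.measurable_chanMat _))
  have := Measure.isProbabilityMeasure_map (μ := μ) hZm.aemeasurable
  have hind := hH.indepFun_direct i k
  rw [← hZ] at hind
  have hlaw := hind.map_prod_eq_prod_map_map (hH.measurable_chanMat _).aemeasurable hZm.aemeasurable
  rw [hH.map_chanMat] at hlaw
  have hpair : Measurable fun ω => (chanMat H (i, i, k) ω, Z ω) :=
    (hH.measurable_chanMat _).prodMk hZm
  obtain ⟨F, hF⟩ : ∃ F : (Fin (2 * d) → Fin d → ℂ) ×
      ((ℕ → ℝ) × (Fin (2 * d) → Fin d → ℂ) × (Fin (2 * d) → Fin d → ℂ)) → ℝ,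
      F = fun z => w z.2.1 * pointToPointRate d P
        ((u (interferenceCov (Matrix.of z.2.2.1) (Matrix.of z.2.2.2)))ᴴ * Matrix.of z.1) := ⟨_, rfl⟩
  have hFm : Measurable F := by
    rw [hF]
    refine (hw.comp (measurable_fst.comp measurable_snd)).mul ?_
    refine EntrywiseMeasurable.pointToPointRate P (EntrywiseMeasurable.mul
      (hu.entrywiseMeasurable (EntrywiseMeasurable.interferenceCov ?_ ?_)).conjTranspose ?_)
    · exact entrywiseMeasurable_of (measurable_fst.comp (measurable_snd.comp measurable_snd))
    · exact entrywiseMeasurable_of (measurable_snd.comp (measurable_snd.comp measurable_snd))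
    · exact entrywiseMeasurable_of measurable_fst
  have hFe : (fun ω => w (fun l => userDist H i l ω) * interferenceFreeRate u H P i k ω) =
      fun ω => F (chanMat H (i, i, k) ω, Z ω) := by
    rw [hF, hZ]; rfl
  have hint : Integrable (fun ω => F (chanMat H (i, i, k) ω, Z ω)) μ := by
    rw [← hFe]
    exact integrable_mul_of_bounded (hw.comp (hH.measurable_userDist_pi i)) (fun ω => hw1 _)
      (integrable_interferenceFreeRate hH hu hP i k)
  have hint' : Integrable F ((iidGaussian (2 * d) d).prod (μ.map Z)) := by
    rw [← hlaw]
    exact (integrable_map_measure hFm.aestronglyMeasurable hpair.aemeasurable).2 hint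
  rw [hFe, ← integral_map hpair.aemeasurable hFm.aestronglyMeasurable, hlaw,
    integral_prod_symm _ hint']
  -- For fixed distances and interference channels the filter is a fixed isometry, so averaging over
  -- the direct channel gives the capacity, whatever `z` is.
  have hinner : ∀ z, ∫ x, F (x, z) ∂(iidGaussian (2 * d) d) = w z.1 * ergodicCapacity d P := by
    intro z
    rw [hF]
    simp only
    rw [integral_const_mul, integral_pointToPointRate_filtered P _
      (hu.orthonormal _ (interferenceCov_posSemidef _ _))]
  have hwf : Measurable fun z : (ℕ → ℝ) × (Fin (2 * d) → Fin d → ℂ) ×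
      (Fin (2 * d) → Fin d → ℂ) => w z.1 := hw.comp measurable_fst
  simp_rw [hinner]
  rw [integral_mul_const, integral_map hZm.aemeasurable hwf.aestronglyMeasurable, hZ]

/-- Any user selected through the distance measures only has an expected rate close to the ergodic
capacity, provided that its distance measure is small. -/
theorem IsSelectedBy.rate_bounds (hH : IsIIDRayleigh μ H) (hu : IsPostfilter d u)
    {P : ℝ} (hP : 0 ≤ P) {i : Fin 3} {K : ℕ} {w : ℕ → (ℕ → ℝ) → ℝ} {κ : Ω → ℕ}
    (hw : IsSelectionRule K w) (hκ : IsSelectedBy μ H i K w κ) :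
    Integrable (fun ω => userRate u H P i (κ ω) ω) μ ∧
    ∫ ω, userRate u H P i (κ ω) ω ∂μ ≤ ergodicCapacity d P ∧
    ∀ x : ℝ, 0 ≤ x → (∀ v : ℕ → ℝ, (∃ l < K, v l < x) → ∀ k, w k v ≠ 0 → v k ≤ x) →
      ergodicCapacity d P - 2 / Real.log 2 * P *
        (∫ h, frobSq (Matrix.of h) ∂(iidGaussian (2 * d) d)) *
        (x + 2 * (((2 * d : ℕ) : ℝ) * d) ^ 2 * μ.real {ω | ∀ k < K, x ≤ userDist H i k ω}) ≤
      ∫ ω, userRate u H P i (κ ω) ω ∂μ := by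
  have := hH.isProbabilityMeasure
  obtain ⟨D, hD⟩ : ∃ D : Ω → ℕ → ℝ, D = fun ω l => userDist H i l ω := ⟨_, rfl⟩
  have hDm : Measurable D := by rw [hD]; exact hH.measurable_userDist_pi i
  have hDk : ∀ k ω, userDist H i k ω = D ω k := fun k ω => by rw [hD]
  have hwn : ∀ k ∈ Finset.range K, ∀ v, ‖w k v‖ ≤ 1 := fun k hk v => by
    rw [Real.norm_of_nonneg (hw.nonneg k v)]; exact hw.le_one (Finset.mem_range.1 hk) v
  have hwm : ∀ k, Measurable fun ω => w k (D ω) := fun k => (hw.measurable k).comp hDm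
  have hind : ∀ k, Integrable ((κ ⁻¹' {k}).indicator (userRate u H P i k)) μ := fun k =>
    (integrable_userRate hH hu hP i k).indicator (hκ.measurable (measurableSet_singleton k))
  have hdec : (fun ω => userRate u H P i (κ ω) ω) =ᵐ[μ]
      fun ω => ∑ k ∈ Finset.range K, (κ ⁻¹' {k}).indicator (userRate u H P i k) ω := by
    filter_upwards [hκ.lt] with ω hω
    rw [Finset.sum_eq_single (κ ω)]
    · simp
    · intro k _ hk
      simp [Set.indicator, hk.symm]
    · intro h; exact absurd (Finset.mem_range.2 hω) h
  have hwf : ∀ k ∈ Finset.range K, Integrable (fun ω => w k (D ω) * userRate u H P i k ω) μ :=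
    fun k hk => integrable_mul_of_bounded (hwm k) (fun ω => hwn k hk _)
      (integrable_userRate hH hu hP i k)
  have hwg : ∀ k ∈ Finset.range K,
      Integrable (fun ω => w k (D ω) * interferenceFreeRate u H P i k ω) μ :=
    fun k hk => integrable_mul_of_bounded (hwm k) (fun ω => hwn k hk _)
      (integrable_interferenceFreeRate hH hu hP i k)
  have hwi : ∀ k ∈ Finset.range K, Integrable (fun ω => w k (D ω)) μ := fun k hk => by
    simpa using integrable_mul_of_bounded (hwm k) (fun ω => hwn k hk _) (integrable_const (1 : ℝ))
  -- Each user's rate is a function `ψ` of all channel entries, so the indicator of its being served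
  -- may be replaced by its weight.
  have hrate : ∫ ω, userRate u H P i (κ ω) ω ∂μ =
      ∑ k ∈ Finset.range K, ∫ ω, w k (D ω) * userRate u H P i k ω ∂μ := by
    rw [integral_congr_ae hdec, integral_finsetSum _ fun k _ => hind k]
    refine Finset.sum_congr rfl fun k hk => ?_
    obtain ⟨ψ, hψ⟩ : ∃ ψ : (Fin 3 × Fin 3 × ℕ × Fin (2 * d) × Fin d → ℂ) → ℝ,
      ψ = fun x => instRate P (Matrix.of fun a b => x (i, i, k, a, b))
        (Matrix.of fun a b => x (i, i + 1, k, a, b)) (Matrix.of fun a b => x (i, i + 2, k, a, b))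
        (u (interferenceCov (Matrix.of fun a b => x (i, i + 1, k, a, b))
          (Matrix.of fun a b => x (i, i + 2, k, a, b)))) := ⟨_, rfl⟩
    have hψm : Measurable ψ := by
      have h : ∀ j : Fin 3, EntrywiseMeasurable
          fun x : Fin 3 × Fin 3 × ℕ × Fin (2 * d) × Fin d → ℂ =>
            (Matrix.of fun a b => x (i, j, k, a, b) : Matrix (Fin (2 * d)) (Fin d) ℂ) :=
        fun j a b => measurable_pi_apply _
      rw [hψ]
      exact EntrywiseMeasurable.instRate P (h _) (h _) (h _)
        (hu.entrywiseMeasurable ((h _).interferenceCov (h _)))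
    have hψe : (fun ω => ψ fun t => channelEntry H t ω) = userRate u H P i k := by
      rw [hψ]; rfl
    have h := hκ.integral_eq k (Finset.mem_range.1 hk) ψ hψm
      (by rw [hψe]; exact integrable_userRate hH hu hP i k)
    rw [hψe] at h
    rw [h, hD]
    exact integral_congr_ae (ae_of_all _ fun ω => by simp only [← hψe])
  have hsum1 : ∑ k ∈ Finset.range K, ∫ ω, w k (D ω) ∂μ = 1 := by
    rw [← integral_finsetSum _ hwi]
    simp only [hw.sum_eq_one]
    simp
  have hfree : ∑ k ∈ Finset.range K, ∫ ω, w k (D ω) * interferenceFreeRate u H P i k ω ∂μ =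
      ergodicCapacity d P := by
    have h : ∀ k ∈ Finset.range K, ∫ ω, w k (D ω) * interferenceFreeRate u H P i k ω ∂μ =
        (∫ ω, w k (D ω) ∂μ) * ergodicCapacity d P := by
      intro k hk
      rw [hD]
      exact integral_weight_mul_interferenceFreeRate hH hu hP i k (hw.measurable k) (hwn k hk)
    rw [Finset.sum_congr rfl h, ← Finset.sum_mul, hsum1, one_mul]
  refine ⟨(integrable_finsetSum _ fun k _ => hind k).congr hdec.symm, ?_, fun x hx hsel => ?_⟩
  · rw [hrate, ← hfree]
    refine Finset.sum_le_sum fun k hk => integral_mono (hwf k hk) (hwg k hk) fun ω => ?_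
    exact mul_le_mul_of_nonneg_left (userRate_le_interferenceFreeRate hu hP i k ω) (hw.nonneg _ _)
  obtain ⟨c, hc⟩ : ∃ c, c = 2 / Real.log 2 * P := ⟨_, rfl⟩
  have hc0 : 0 ≤ c := by
    have : 0 < Real.log 2 := Real.log_pos one_lt_two
    rw [hc]; positivity
  obtain ⟨M, hM⟩ : ∃ M : ℝ, M = 2 * (((2 * d : ℕ) : ℝ) * d) ^ 2 := ⟨_, rfl⟩
  have hM0 : 0 ≤ M := by rw [hM]; positivity
  obtain ⟨N, hN⟩ : ∃ N : ℝ, N = ∫ h, frobSq (Matrix.of h) ∂(iidGaussian (2 * d) d) := ⟨_, rfl⟩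
  have hN0 : 0 ≤ N := by rw [hN]; exact integral_nonneg fun h => frobSq_nonneg _
  rw [← hc, ← hM, ← hN]
  have hDM : ∀ ω k, D ω k ≤ M := fun ω k => by rw [← hDk, hM]; exact userDist_le i k ω
  have hD0 : ∀ ω k, 0 ≤ D ω k := fun ω k => by rw [← hDk]; exact userDist_nonneg i k ω
  have hDkm : ∀ k, Measurable fun ω => D ω k := fun k => (measurable_pi_apply k).comp hDm
  have hwDn : ∀ k ∈ Finset.range K, ∀ ω, ‖w k (D ω) * D ω k‖ ≤ M := fun k hk ω => by
    rw [norm_mul, Real.norm_of_nonneg (hD0 ω k)]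
    calc _ ≤ 1 * M := mul_le_mul (hwn k hk _) (hDM ω k) (hD0 ω k) zero_le_one
      _ = M := one_mul M
  have hwD : ∀ k ∈ Finset.range K, Integrable (fun ω => w k (D ω) * D ω k) μ := fun k hk => by
    simpa using integrable_mul_of_bounded ((hwm k).mul (hDkm k)) (hwDn k hk)
      (integrable_const (1 : ℝ))
  have hwDF : ∀ k ∈ Finset.range K, Integrable (fun ω => w k (D ω) * D ω k *
      frobSq (Matrix.of (chanMat H (i, i + 2, k) ω))) μ := fun k hk =>
    integrable_mul_of_bounded ((hwm k).mul (hDkm k)) (hwDn k hk)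
      (hH.integrable_frobSq_chanMat _)
  -- Weight and distance are functions of the family of all distances, which is independent of the
  -- second interference channel.
  have hfac : ∀ k, ∫ ω, w k (D ω) * D ω k * frobSq (Matrix.of (chanMat H (i, i + 2, k) ω)) ∂μ =
      (∫ ω, w k (D ω) * D ω k ∂μ) * N := by
    intro k
    have h1 : IndepFun D (chanMat H (i, i + 2, k)) μ := by
      rw [hD]; exact (hH.indepFun_chanMat_userDist i k).symm
    have hF : Measurable fun h : Fin (2 * d) → Fin d → ℂ => frobSq (Matrix.of h) :=
      (entrywiseMeasurable_of measurable_id).frobSq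
    have hV : Measurable fun v : ℕ → ℝ => w k v * v k := (hw.measurable k).mul (measurable_pi_apply k)
    have h2 : IndepFun (fun ω => w k (D ω) * D ω k)
      (fun ω => frobSq (Matrix.of (chanMat H (i, i + 2, k) ω))) μ := h1.comp hV hF
    rw [h2.integral_fun_mul_eq_mul_integral (hV.comp hDm).aestronglyMeasurable
      (hF.comp (hH.measurable_chanMat _)).aestronglyMeasurable, hH.integral_frobSq_chanMat, hN]
  have hloss : ∀ k ∈ Finset.range K, ∫ ω, w k (D ω) * interferenceFreeRate u H P i k ω ∂μ ≤
      (∫ ω, w k (D ω) * userRate u H P i k ω ∂μ) + c * N * ∫ ω, w k (D ω) * D ω k ∂μ := by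
    intro k hk
    calc ∫ ω, w k (D ω) * interferenceFreeRate u H P i k ω ∂μ
        ≤ ∫ ω, (w k (D ω) * userRate u H P i k ω +
            c * (w k (D ω) * D ω k * frobSq (Matrix.of (chanMat H (i, i + 2, k) ω)))) ∂μ := by
          refine integral_mono_ae (hwg k hk) ((hwf k hk).add ((hwDF k hk).const_mul c)) ?_
          filter_upwards [interferenceFreeRate_le hH hu hP i k] with ω hω
          rw [← hc, hDk] at hω
          have := mul_le_mul_of_nonneg_left hω (hw.nonneg k (D ω))
          refine this.trans_eq ?_
          ring
      _ = _ := by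
          rw [integral_add (hwf k hk) ((hwDF k hk).const_mul c), integral_const_mul, hfac]
          ring
  have hout : MeasurableSet {ω | ∀ k < K, x ≤ userDist H i k ω} := by
    have : {ω | ∀ k < K, x ≤ userDist H i k ω} =
        ⋂ k ∈ Finset.range K, {ω | x ≤ userDist H i k ω} := by
      ext ω; simp
    rw [this]
    exact Finset.measurableSet_biInter _ fun k _ =>
      measurableSet_le measurable_const (hH.measurable_userDist i k)
  -- Outside the outage event every user with positive weight has distance at most `x`; on it the
  -- uniform bound `M` is used.
  have hdist : ∑ k ∈ Finset.range K, ∫ ω, w k (D ω) * D ω k ∂μ ≤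
      x + M * μ.real {ω | ∀ k < K, x ≤ userDist H i k ω} := by
    rw [← integral_finsetSum _ hwD]
    have hi1 : Integrable (({ω | ∀ k < K, x ≤ userDist H i k ω}).indicator (1 : Ω → ℝ)) μ :=
      (integrable_const (1 : ℝ)).indicator hout
    have hi : Integrable (fun ω => x + M *
        ({ω | ∀ k < K, x ≤ userDist H i k ω}).indicator (1 : Ω → ℝ) ω) μ :=
      (integrable_const x).add (hi1.const_mul M)
    calc ∫ ω, ∑ k ∈ Finset.range K, w k (D ω) * D ω k ∂μ
        ≤ ∫ ω, (x + M * ({ω | ∀ k < K, x ≤ userDist H i k ω}).indicator (1 : Ω → ℝ) ω) ∂μ := by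
          refine integral_mono (integrable_finsetSum _ hwD) hi fun ω => ?_
          by_cases h : ω ∈ {ω | ∀ k < K, x ≤ userDist H i k ω}
          · simp only [Set.indicator_of_mem h, Pi.one_apply, mul_one]
            have := hw.sum_mul_le (v := D ω) (y := M) fun k _ _ => hDM ω k
            linarith
          · simp only [Set.indicator_of_notMem h, mul_zero, add_zero]
            refine hw.sum_mul_le fun k _ hk0 => hsel (D ω) ?_ k hk0
            by_contra hne
            push Not at hne
            exact h fun k hk => by rw [hDk]; exact hne k hk
      _ = _ := by
          rw [integral_add (integrable_const x) (hi1.const_mul M), integral_const_mul,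
            integral_indicator_one hout]
          simp
  rw [hrate]
  have h1 := Finset.sum_le_sum hloss
  rw [hfree, Finset.sum_add_distrib, ← Finset.mul_sum] at h1
  have h2 := mul_le_mul_of_nonneg_left hdist (mul_nonneg hc0 hN0)
  linarith

end Network


/-! ### Asymptotics of the threshold -/

theorem ballConst_pos (d : ℕ) : 0 < ballConst d := by
  unfold ballConst
  refine mul_pos (one_div_pos.2 (Real.Gamma_pos_of_pos (by positivity)))
    (Finset.prod_pos fun i hi => ?_)
  have hi' : (i : ℝ) ≤ d := by exact_mod_cast (Finset.mem_Icc.1 hi).2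
  have hd : (0 : ℝ) ≤ d := Nat.cast_nonneg d
  exact div_pos (Real.Gamma_pos_of_pos (by linarith)) (Real.Gamma_pos_of_pos (by linarith))

theorem tendsto_log_natCast : Tendsto (fun K : ℕ => Real.log K) atTop atTop :=
  Real.tendsto_log_atTop.comp tendsto_natCast_atTop_atTop

/-- The numerator of the threshold dominates a multiple of `log K`. -/
theorem eventually_le_oneBit_numerator {d : ℕ} (hd : 1 ≤ d) {B : ℕ → ℝ}
    (hB : B =o[atTop] (fun K : ℕ => Real.log K)) :
    ∀ᶠ K : ℕ in atTop, 1 / (2 * (d : ℝ) ^ 2) * Real.log K ≤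
      1 / (d : ℝ) ^ 2 * Real.log K + B K := by
  have hd' : (0 : ℝ) < d := by exact_mod_cast hd
  -- Eventually `|B K|` is at most half of the leading term, so half of that term survives.
  filter_upwards [hB.bound (c := 1 / (2 * (d : ℝ) ^ 2)) (by positivity),
    tendsto_log_natCast.eventually_ge_atTop 0] with K h h0
  rw [Real.norm_of_nonneg h0] at h
  have h1 := (abs_le.1 (Real.norm_eq_abs _ ▸ h)).1
  have h2 : 1 / (d : ℝ) ^ 2 * Real.log K = 2 * (1 / (2 * (d : ℝ) ^ 2) * Real.log K) := by
    field_simp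
  linarith

theorem tendsto_oneBit_ratio {d : ℕ} {B : ℕ → ℝ} (hB : B =o[atTop] (fun K : ℕ => Real.log K)) :
    Tendsto (fun K : ℕ => (1 / (d : ℝ) ^ 2 * Real.log K + B K) / (ballConst d * K)) atTop (𝓝 0) := by
  have h1 : (fun K : ℕ => 1 / (d : ℝ) ^ 2 * Real.log K + B K) =O[atTop]
      (fun K : ℕ => Real.log K) :=
    ((isBigO_refl _ _).const_mul_left _).add hB.isBigO
  have h2 : (fun K : ℕ => Real.log K) =o[atTop] (fun K : ℕ => ballConst d * (K : ℝ)) :=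
    (Real.isLittleO_log_id_atTop.comp_tendsto tendsto_natCast_atTop_atTop).const_mul_right
      (ballConst_pos d).ne'
  exact (h1.trans_isLittleO h2).tendsto_div_nhds_zero

theorem tendsto_oneBitThreshold {d : ℕ} (hd : 1 ≤ d) {B : ℕ → ℝ}
    (hB : B =o[atTop] (fun K : ℕ => Real.log K)) :
    Tendsto (fun K => oneBitThreshold d K (B K)) atTop (𝓝 0) := by
  have hd' : (0 : ℝ) < d := by exact_mod_cast hd
  have h := (tendsto_oneBit_ratio (d := d) hB).rpow_const (p := 1 / (d : ℝ) ^ 2)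
    (Or.inr (by positivity))
  rwa [Real.zero_rpow (by positivity)] at h

/-- The right-hand side is, up to a constant, the exponent in the outage bound; that it diverges is
what makes outages rare. -/
theorem eventually_oneBitThreshold_pow {d : ℕ} (hd : 1 ≤ d) {B : ℕ → ℝ}
    (hB : B =o[atTop] (fun K : ℕ => Real.log K)) :
    ∀ᶠ K : ℕ in atTop, 0 < oneBitThreshold d K (B K) ∧
      1 / (2 * (d : ℝ) ^ 2 * ballConst d) * Real.log K ≤
        oneBitThreshold d K (B K) ^ (d ^ 2) * K := by
  have hd' : (0 : ℝ) < d := by exact_mod_cast hd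
  have hc := ballConst_pos d
  filter_upwards [eventually_le_oneBit_numerator hd hB,
    tendsto_log_natCast.eventually_gt_atTop 0, eventually_gt_atTop 0] with K h h0 hK
  have hK' : (0 : ℝ) < K := by exact_mod_cast hK
  have hnum : 0 < 1 / (d : ℝ) ^ 2 * Real.log K + B K := lt_of_lt_of_le (by positivity) h
  have hy : 0 < (1 / (d : ℝ) ^ 2 * Real.log K + B K) / (ballConst d * K) := by positivity
  refine ⟨Real.rpow_pos_of_pos hy _, ?_⟩
  have hp : oneBitThreshold d K (B K) ^ (d ^ 2) =
      (1 / (d : ℝ) ^ 2 * Real.log K + B K) / (ballConst d * K) := by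
    unfold oneBitThreshold
    rw [← Real.rpow_natCast, ← Real.rpow_mul hy.le]
    have : 1 / (d : ℝ) ^ 2 * ((d ^ 2 : ℕ) : ℝ) = 1 := by push_cast; field_simp
    rw [this, Real.rpow_one]
  have hq : (1 / (d : ℝ) ^ 2 * Real.log K + B K) / (ballConst d * K) * K =
      (1 / (d : ℝ) ^ 2 * Real.log K + B K) / ballConst d := by field_simp
  rw [hp, hq, le_div_iff₀ hc]
  refine le_trans (le_of_eq ?_) h
  field_simp

/-! ### Vanishing outage probability and convergence of the rates -/

section Network

variable {Ω : Type*} {d : ℕ} {H : Fin 3 → Fin 3 → ℕ → Ω → Matrix (Fin (2 * d)) (Fin d) ℂ}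
  [MeasurableSpace Ω] {μ : Measure Ω}

/-- The probability of a scheduling outage vanishes. -/
theorem IsIIDRayleigh.tendsto_measure_outage (hH : IsIIDRayleigh μ H) (hd : 1 ≤ d) (i : Fin 3)
    {B : ℕ → ℝ} (hB : B =o[atTop] (fun K : ℕ => Real.log K)) :
    Tendsto (fun K : ℕ => μ.real {ω | ∀ k < K, oneBitThreshold d K (B K) ≤ userDist H i k ω})
      atTop (𝓝 0) := by
  have hd' : (0 : ℝ) < d := by exact_mod_cast hd
  obtain ⟨c, hc, h⟩ := hH.exists_measure_outage_le hd i
  have hb := ballConst_pos d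
  have hlim : Tendsto (fun K : ℕ =>
      Real.exp (-(c * (1 / (2 * (d : ℝ) ^ 2 * ballConst d) * Real.log K)))) atTop (𝓝 0) :=
    Real.tendsto_exp_neg_atTop_nhds_zero.comp
      ((tendsto_log_natCast.const_mul_atTop (by positivity)).const_mul_atTop hc)
  refine squeeze_zero' (Eventually.of_forall fun _ => measureReal_nonneg) ?_ hlim
  filter_upwards [eventually_oneBitThreshold_pow hd hB,
    (tendsto_oneBitThreshold hd hB).eventually_le_const zero_lt_one] with K hK h1
  refine (h _ hK.1 h1 K).trans (Real.exp_le_exp.2 (neg_le_neg ?_))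
  rw [mul_assoc c (oneBitThreshold d K (B K) ^ d ^ 2)]
  exact mul_le_mul_of_nonneg_left hK.2 hc.le

/-- The expected rate of the served users tends to the ergodic capacity if the selection rules
serve only users below the threshold, unless there is none. -/
theorem IsSelectedBy.tendsto_rate (hH : IsIIDRayleigh μ H) (hd : 1 ≤ d)
    {u : Matrix (Fin (2 * d)) (Fin (2 * d)) ℂ → Matrix (Fin (2 * d)) (Fin d) ℂ}
    (hu : IsPostfilter d u) {P : ℕ → ℝ} (hP0 : ∀ K, 0 ≤ P K)
    (hP : P =O[atTop] (fun _ => (1 : ℝ))) {B : ℕ → ℝ}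
    (hB : B =o[atTop] (fun K : ℕ => Real.log K)) {i : Fin 3}
    {w : ℕ → ℕ → (ℕ → ℝ) → ℝ} {κ : ℕ → Ω → ℕ}
    (hw : ∀ K, 1 ≤ K → IsSelectionRule K (w K))
    (hκ : ∀ K, 1 ≤ K → IsSelectedBy μ H i K (w K) (κ K))
    (hsel : ∀ K, 1 ≤ K → ∀ v : ℕ → ℝ, (∃ l < K, v l < oneBitThreshold d K (B K)) →
      ∀ k, w K k v ≠ 0 → v k ≤ oneBitThreshold d K (B K)) :
    Tendsto (fun K => (∫ ω, userRate u H (P K) i (κ K ω) ω ∂μ) - ergodicCapacity d (P K))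
      atTop (𝓝 0) := by
  have hlim : Tendsto (fun K : ℕ => oneBitThreshold d K (B K) + 2 * (((2 * d : ℕ) : ℝ) * d) ^ 2 *
      μ.real {ω | ∀ k < K, oneBitThreshold d K (B K) ≤ userDist H i k ω}) atTop (𝓝 0) := by
    simpa using (tendsto_oneBitThreshold hd hB).add
      ((hH.tendsto_measure_outage hd i hB).const_mul (2 * (((2 * d : ℕ) : ℝ) * d) ^ 2))
  have hbdd : (fun K => 2 / Real.log 2 * P K *
      ∫ h, frobSq (Matrix.of h) ∂(iidGaussian (2 * d) d)) =O[atTop] (fun _ => (1 : ℝ)) := by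
    refine IsBigO.trans (g := P) ?_ hP
    exact (((isBigO_refl P atTop).const_mul_left (2 / Real.log 2 *
      ∫ h, frobSq (Matrix.of h) ∂(iidGaussian (2 * d) d))).congr_left fun K => by ring)
  have hprod : Tendsto (fun K : ℕ => 2 / Real.log 2 * P K *
      (∫ h, frobSq (Matrix.of h) ∂(iidGaussian (2 * d) d)) *
      (oneBitThreshold d K (B K) + 2 * (((2 * d : ℕ) : ℝ) * d) ^ 2 *
      μ.real {ω | ∀ k < K, oneBitThreshold d K (B K) ≤ userDist H i k ω})) atTop (𝓝 0) := by
    have := hbdd.mul_isLittleO ((isLittleO_one_iff ℝ).2 hlim)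
    simpa using this
  -- The difference lies between minus the loss bound and zero. The lower bound needs a nonnegative
  -- threshold, which holds for large `K` only.
  refine tendsto_of_tendsto_of_tendsto_of_le_of_le' (by simpa only [neg_zero] using hprod.neg)
    tendsto_const_nhds ?_ ?_
  · filter_upwards [eventually_ge_atTop 1, eventually_oneBitThreshold_pow hd hB] with K hK hx
    have := (IsSelectedBy.rate_bounds hH hu (hP0 K) (hw K hK) (hκ K hK)).2.2 _ hx.1.le (hsel K hK)
    linarith
  · filter_upwards [eventually_ge_atTop 1] with K hK
    have := (IsSelectedBy.rate_bounds hH hu (hP0 K) (hw K hK) (hκ K hK)).2.1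
    linarith

end Network

end

theorem theorem3 {Ω : Type*} [MeasurableSpace Ω] (μ : Measure Ω) [IsProbabilityMeasure μ]
    (d : ℕ) (hd : 1 ≤ d)
    -- the channels, i.i.d. Rayleigh
    (H : Fin 3 → Fin 3 → ℕ → Ω → Matrix (Fin (2 * d)) (Fin d) ℂ) (hH : IsIIDRayleigh μ H)
    -- the postfilter
    (u : Matrix (Fin (2 * d)) (Fin (2 * d)) ℂ → Matrix (Fin (2 * d)) (Fin d) ℂ)
    (hu : IsPostfilter d u)
    -- the transmit power, bounded as the number `K` of users per cell grows
    (P : ℕ → ℝ) (hP0 : ∀ K, 0 ≤ P K) (hP : P =O[atTop] (fun _ => (1 : ℝ)))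
    -- the free parameter of the threshold
    (B : ℕ → ℝ) (hB : B =o[atTop] (fun K : ℕ => Real.log K))
    -- the user selected in each cell under 1-bit feedback
    (kDagger : ℕ → Fin 3 → Ω → ℕ)
    (hk : ∀ K, 1 ≤ K → ∀ i, IsUniformPick (channelSigma H) μ
      (fun ω => oneBitCandidates (fun k => userDist H i k ω) (oneBitThreshold d K (B K)) K)
      (kDagger K i)) :
    (∀ p : ℝ, 0 ≤ p →
      Integrable (fun g => pointToPointRate d p (Matrix.of g)) (gaussianMatrixLaw d)) ∧
    ∀ i : Fin 3,
      (∀ K, 1 ≤ K →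
        Integrable (fun ω => userRate u H (P K) i (kDagger K i ω) ω) μ ∧
        Integrable
          (fun ω => userRate u H (P K) i (bestUser (fun k => userDist H i k ω) K) ω) μ) ∧
      Tendsto (fun K : ℕ =>
        (∫ ω, userRate u H (P K) i (kDagger K i ω) ω ∂μ) -
        ∫ ω, userRate u H (P K) i (bestUser (fun k => userDist H i k ω) K) ω ∂μ)
        atTop (𝓝 0) ∧
      Tendsto (fun K : ℕ =>
        (∫ ω, userRate u H (P K) i (kDagger K i ω) ω ∂μ) - ergodicCapacity d (P K))
        atTop (𝓝 0) ∧
      Tendsto (fun K : ℕ =>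
        (∫ ω, userRate u H (P K) i (bestUser (fun k => userDist H i k ω) K) ω ∂μ) -
          ergodicCapacity d (P K))
        atTop (𝓝 0) := by

  refine ⟨fun p hp => integrable_pointToPointRate hp, fun i => ?_⟩
  have hbest : ∀ K, 1 ≤ K → IsSelectedBy μ H i K (bestWeight K)
      (fun ω => bestUser (fun k => userDist H i k ω) K) :=
    fun K hK => isSelectedBy_bestUser hH i hK
  have hone : ∀ K, 1 ≤ K → IsSelectedBy μ H i K (oneBitWeight (oneBitThreshold d K (B K)) K)
      (kDagger K i) := fun K hK => isSelectedBy_oneBit hH i (hk K hK i)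
  have hlim_one := IsSelectedBy.tendsto_rate hH hd hu hP0 hP hB
    (fun K hK => isSelectionRule_oneBitWeight _ hK) hone
    (fun K _ v hv => oneBitWeight_ne_zero hv)
  have hlim_best := IsSelectedBy.tendsto_rate hH hd hu hP0 hP hB
    (fun K hK => isSelectionRule_bestWeight hK) hbest
    (fun K hK v hv => bestWeight_ne_zero hK hv)
  refine ⟨fun K hK => ⟨?_, ?_⟩, ?_, hlim_one, hlim_best⟩
  · exact (IsSelectedBy.rate_bounds hH hu (hP0 K) (isSelectionRule_oneBitWeight _ hK)
      (hone K hK)).1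
  · exact (IsSelectedBy.rate_bounds hH hu (hP0 K) (isSelectionRule_bestWeight hK)
      (hbest K hK)).1
  -- The capacity cancels in the difference of the two limits.
  · simpa using hlim_one.sub hlim_best
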